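/- **Setting.** Let $\mathbb F_q\subset\mathbb F_{q^m}\subset\mathbb F_{q^{m\eta}}$ be finite fields, $k\le n$, $r\ge 1$, $N=2^D$. An instance of Rank-SD is $(\boldsymbol H,\boldsymbol y)$ with $\boldsymbol H=(\boldsymbol I\,\|\,\boldsymbol H')\in\mathbb F_{q^m}^{(n-k)\times n}$ and $\boldsymbol y\in\mathbb F_{q^m}^{n-k}$; a *witness* is $\boldsymbol x\in\mathbb F_{q^m}^n$ with $\boldsymbol H\boldsymbol x=\boldsymbol y$ and $W_R(\boldsymbol x)\le r$, where $W_R(\boldsymbol x)$ is the rank over $\mathbb F_q$ of the matrix of coordinates of $x_1,\dots,x_n$ in an $\mathbb F_q$-basis of $\mathbb F_{q^m}$. **Protocol.** A commitment scheme $\mathsf{Com}$, a hash function $\mathsf H$, a pseudo-random generator and a seed tree (GGM tree) with $N$ leaves are fixed (arbitrary functions). The leaves are indexed by $i\in\{1,2\}^D$; the last one, $(2,\dots,2)$, is leaf $N$. Leaf $i\neq N$ has state $\mathsf{state}_i=\mathsf{seed}_i$, from which its shares $[\boldsymbol x_B]_i\in\mathbb F_{q^m}^k$, $[\boldsymbol\beta]_i\in\mathbb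 F_{q^m}^{r-1}$, $[\boldsymbol a]_i\in\mathbb F_{q^{m\eta}}^{r-1}$, $[c]_i\in\mathbb F_{q^{m\eta}}$ are generated; leaf $N$ has state $(\mathsf{seed}_N,[\boldsymbol x_B]_N,[\boldsymbol\beta]_N,[c]_N)$, and $[\boldsymbol a]_N$ is generated from $\mathsf{seed}_N$. The main party $(d,b)$, for $1\le d\le D$ and $b\in\{1,2\}$, holds the sums of the shares of the leaves $i$ with $i_d=b$. 1. The prover sends $h_0$ (meant to be $\mathsf H(\mathsf{cmt}_1,\dots,\mathsf{cmt}_N)$ with $\mathsf{cmt}_i=\mathsf{Com}(\mathsf{state}_i,\rho_i)$). 2. The verifier sends uniform $(\gamma_1,\dots,\gamma_n,\varepsilon)\in\mathbb F_{q^{m\eta}}^{n+1}$. 3. The prover sends $h_1$ (meant to be $\mathsf H(H_1,\dots,H_D)$ with $H_d=\mathsf H([\boldsymbol\alpha]_{(d,\cdot)},[v]_{(d,\cdot)})$). 4. The verifier sends a uniform leaf $i^*$. 5. The prover sends the salt and the sibling path of $i^*$ in the seed tree, which determine $(\mathsf{seed}_j,\rho_j)$ for $j\neq i^*$; $[\boldsymbol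 x_B]_N,[\boldsymbol\beta]_N,[c]_N$ if $i^*\ne N$; $\mathsf{cmt}_{i^*}$; and the share $[\boldsymbol\alpha]_{i^*}$. A party with shares $[\cdot]$ computes $[\boldsymbol x]=([\boldsymbol y]-\boldsymbol H'[\boldsymbol x_B]\,\|\,[\boldsymbol x_B])$, where $[\boldsymbol y]=\boldsymbol y$ for leaf $N$ and for the main parties containing it and $[\boldsymbol y]=0$ otherwise; then, for $1\le e\le r-1$, $[\alpha_e]=\varepsilon\sum_j\gamma_j([x_j]^{q^e}-[x_j])+[a_e]$; and, with $\boldsymbol\alpha$ the sum of the two shares of $\boldsymbol\alpha$ in dimension $d$, $[v]=-\varepsilon\sum_j\gamma_j([x_j]^{q^r}-[x_j])-\langle\boldsymbol\alpha,[\boldsymbol\beta]\rangle-[c]$. The verifier does this for the main parties not containing $i^*$; for the one containing $i^*$ in dimension $d$, the share of $\boldsymbol\alpha$ is the sum of the received $[\boldsymbol\alpha]_{i^*}$ and of those of its other leaves, and the share of $v$ is set so that the two shares of $v$ sum to $0$. The verifier accepts if the recomputed commitments hash to $h_0$, $v=0$ in all dimensions, $\boldsymbol\alpha$ is the same in all dimensions,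 and the recomputed hashes give $h_1$. **Provers and extractors.** A prover $\tilde{\mathcal P}$ is given by a distribution of random tapes and, for each tape, its messages as functions of the challenges received. An extractor with rewindable access makes calls to $\tilde{\mathcal P}$; a call is an execution of the protocol with challenges of the extractor's choice, on a fresh random tape or on that of an earlier call. It chooses its calls at random, depending on its earlier calls and on whether they were accepted. It halts as soon as two of the transcripts obtained yield a *commitment collision* (two openings of a leaf commitment to distinct states, or two distinct inputs of $\mathsf H$ with the same hash, occurring in the verification of these two transcripts) or a witness, namely $(\boldsymbol y-\boldsymbol H'\boldsymbol x_B\,\|\,\boldsymbol x_B)$ with $\boldsymbol x_B$ the sum of the shares of all $N$ leaves read from two transcripts with distinct hidden leaves, and outputs it. **Theorem.** Let $p=\frac{2}{q^{m\eta}}-\frac1{q^{2m\eta}}$, $\epsilon=p+(1-p)\frac1N$ and $\tilde\epsilon>\epsilon$. There is an extractor $\mathcal E$ such that for all choices of the primitives, every instance $(\boldsymbol H,\boldsymbol y)$ and every prover $\tilde{\mathcal P}$ that makes the verifier accept with probability $\tilde\epsilon$, $\mathcal E$ halts with probability $1$ and outputs a commitment collision or a witness of the instance, and its expected number of calls to $\tilde{\mathcal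 P}$ is at most $$\frac{4}{\tilde\epsilon-\epsilon}\left(1+\frac{2\tilde\epsilon\ln 2}{\tilde\epsilon-\epsilon}\right).$$ -/

import Mathlib

open scoped ENNReal Topology

noncomputable section

namespace RankSD

/-! ### Rank metric and the rank syndrome decoding relation -/

/-- Coordinates of a vector `x = (x_A ‖ x_B)` of length `n`, with `x_A` of length `n - k` and
`x_B` of length `k`. -/
abbrev Coord (n k : ℕ) := Fin (n - k) ⊕ Fin k

/-- Rank weight over `F` of a vector with entries in the extension `K`: the rank of the matrix of
the coordinates of its entries in a basis of `K` over `F`. -/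
def rankWeight (F : Type*) {K ι : Type*} [Field F] [Field K] [Algebra F K] [Module.Finite F K]
    (x : ι → K) : ℕ :=
  Matrix.rank (Matrix.of fun i j => (Module.finBasis F K).repr (x i) j)

/-- Public data: the non-identity block of a parity check matrix in standard form, and a
syndrome. -/
structure Instance (K : Type*) (n k : ℕ) where
  H' : Matrix (Fin (n - k)) (Fin k) K
  y : Fin (n - k) → K

/-- The parity check matrix `H = (I ‖ H')`. -/
def Instance.H {K : Type*} [Field K] {n k : ℕ} (I : Instance K n k) :
    Matrix (Fin (n - k)) (Coord n k) K :=
  Matrix.fromCols 1 I.H'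

/-- `x` is a good witness: `H x = y` and `x` has rank weight at most `r`. -/
def Instance.IsWitness (F : Type*) {K : Type*} [Field F] [Field K] [Algebra F K]
    [Module.Finite F K] {n k : ℕ} (I : Instance K n k) (r : ℕ) (x : Coord n k → K) : Prop :=
  I.H.mulVec x = I.y ∧ rankWeight F x ≤ r

/-! ### Shares and the multi-party computation -/

/-- An additive share of `(x_B, β, a, c)`. The entries of `β` and `a` are those of
index `1, …, r - 1`. Here `K` has `q ^ m` elements and `L` has `q ^ (m η)`. -/
@[ext] structure Share (K L : Type*) (k r : ℕ) where
  xB : Fin k → K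
  β : Fin (r - 1) → K
  a : Fin (r - 1) → L
  c : L

/-- Sum of a family of shares. -/
def Share.sum {K L ι : Type*} [Field K] [Field L] {k r : ℕ} (s : Finset ι)
    (f : ι → Share K L k r) : Share K L k r where
  xB := ∑ i ∈ s, (f i).xB
  β := ∑ i ∈ s, (f i).β
  a := ∑ i ∈ s, (f i).a
  c := ∑ i ∈ s, (f i).c

/-- First challenge: `((γ_j)_j, ε)`. -/
abbrev Ch1 (L : Type*) (n k : ℕ) := (Coord n k → L) × L

/-- The `N = 2 ^ D` leaf parties, indexed by their coordinates on the hypercube. -/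
abbrev Leaf (D : ℕ) := Fin D → Bool

/-- The leaf party of number `N`, whose coordinates are all maximal. -/
def lastLeaf (D : ℕ) : Leaf D := fun _ => true

section MPC

variable {K L : Type*} [Field K] [Field L] [Algebra K L] {n k r : ℕ}

/-- The vector `x = (y - H' x_B ‖ x_B)`. For additive shares only one party adds the constant
`y`: `const` tells whether the party at hand is that one. -/
def fullVec (I : Instance K n k) (const : Prop) [Decidable const] (xB : Fin k → K) :
    Coord n k → K :=
  Sum.elim ((if const then I.y else 0) - I.H'.mulVec xB) xB

/-- `∑_j γ_j (x_j ^ (q ^ e) - x_j)`. -/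
def frobSum (q : ℕ) (γ : Coord n k → L) (x : Coord n k → K) (e : ℕ) : L :=
  ∑ j, γ j * algebraMap K L (x j ^ q ^ e - x j)

/-- The share of `α = ε ω + a` computed by a party, where `ω_e = ∑_j γ_j (x_j ^ (q ^ e) - x_j)`
for `e = 1, …, r - 1`. -/
def alphaShare (q : ℕ) (I : Instance K n k) (ch : Ch1 L n k) (const : Prop) [Decidable const]
    (s : Share K L k r) : Fin (r - 1) → L :=
  fun e => ch.2 * frobSum q ch.1 (fullVec I const s.xB) (e.val + 1) + s.a e

/-- The share of `v = ε z - ⟨α, β⟩ - c` computed by a party from the opened value `α`, where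
`z = -∑_j γ_j (x_j ^ (q ^ r) - x_j)`. -/
def vShare (q : ℕ) (I : Instance K n k) (ch : Ch1 L n k) (const : Prop) [Decidable const]
    (α : Fin (r - 1) → L) (s : Share K L k r) : L :=
  ch.2 * (-frobSum q ch.1 (fullVec I const s.xB) r)
    - (∑ e, α e * algebraMap K L (s.β e)) - s.c

end MPC

/-! ### Symmetric primitives -/

/-- Committed state of a leaf: its seed, together with the shares of `x_B`, `β`, `c` for the
last leaf. -/
inductive LeafState (K L : Type*) (k r : ℕ) (Seed : Type*)
  | plain (seed : Seed)
  | last (seed : Seed) (xB : Fin k → K) (β : Fin (r - 1) → K) (c : L)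

/-- The symmetric primitives of the protocol. They are arbitrary functions. The hash function is
used on three kinds of input, and is represented by its restrictions to them. -/
structure Primitives (K L : Type*) (k r D : ℕ) (Seed Salt Rnd Cmt Dig : Type*) where
  /-- one expansion step of the seed tree -/
  ggm : Salt → Seed → Seed × Seed
  /-- seed and commitment randomness of a leaf, from the leaf node of the seed tree -/
  leafOut : Salt → Seed → Seed × Rnd
  /-- pseudo-random generation of a share -/
  prg : Seed → Share K L k r
  /-- commitment scheme -/
  com : LeafState K L k r Seed → Rnd → Cmt
  /-- hash of the `N` leaf commitments, giving `h₀` -/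
  hashCmts : (Leaf D → Cmt) → Dig
  /-- hash of the shares of `α` and `v` of the two main parties of a dimension, giving `H_d` -/
  hashExec : (Bool → Fin (r - 1) → L) × (Bool → L) → Dig
  /-- hash of `(H_1, …, H_D)`, giving `h₁` -/
  hashAll : (Fin D → Dig) → Dig

/-- Second response of the prover for the hidden leaf `i*`: the salt and the sibling path of `i*`
in the seed tree (`path l` is the seed of the node that leaves the path to `i*` at level `l`), the
shares of `x_B`, `β`, `c` of the last leaf (ignored if the last leaf is the hidden one), the
commitment of the hidden leaf and its share of `α`. -/
structure Response (K L : Type*) (k r D : ℕ) (Seed Salt Cmt : Type*) where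
  salt : Salt
  path : Fin D → Seed
  auxXB : Fin k → K
  auxβ : Fin (r - 1) → K
  auxC : L
  cmt : Cmt
  α : Fin (r - 1) → L

/-- A transcript `(h₀, ch₁, h₁, ch₂, rsp)`. -/
structure Transcript (K L : Type*) (n k r D : ℕ) (Seed Salt Cmt Dig : Type*) where
  h0 : Dig
  ch1 : Ch1 L n k
  h1 : Dig
  ch2 : Leaf D
  rsp : Response K L k r D Seed Salt Cmt

/-- First coordinate at which two distinct leaves differ. -/
def firstDiff {D : ℕ} (i j : Leaf D) (h : j ≠ i) : Fin D :=
  (Finset.univ.filter fun l => j l ≠ i l).min' (by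
    obtain ⟨l, hl⟩ := Function.ne_iff.mp h
    exact ⟨l, by simpa using hl⟩)

section Verification

variable {K L : Type*} [Field K] [Field L] [Algebra K L] {n k r D : ℕ}
  {Seed Salt Rnd Cmt Dig : Type*}
  (S : Primitives K L k r D Seed Salt Rnd Cmt Dig) (I : Instance K n k) (q : ℕ)
  (T : Transcript K L n k r D Seed Salt Cmt Dig)

/-- Shares encoded by the state of a leaf. -/
def Primitives.shareOf : LeafState K L k r Seed → Share K L k r
  | .plain s => S.prg s
  | .last s xB β c => { xB := xB, β := β, a := (S.prg s).a, c := c }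

namespace Transcript

/-- The node of the seed tree at an opened leaf `j`, recomputed from the sibling path. -/
def leafNode (j : {j : Leaf D // j ≠ T.ch2}) : Seed :=
  ((List.ofFn j.1).drop ((firstDiff T.ch2 j.1 j.2).val + 1)).foldl
    (fun s b => if b then (S.ggm T.rsp.salt s).2 else (S.ggm T.rsp.salt s).1)
    (T.rsp.path (firstDiff T.ch2 j.1 j.2))

/-- State of an opened leaf. -/
def state (j : {j : Leaf D // j ≠ T.ch2}) : LeafState K L k r Seed :=
  let s := (S.leafOut T.rsp.salt (T.leafNode S j)).1
  if j.1 = lastLeaf D then .last s T.rsp.auxXB T.rsp.auxβ T.rsp.auxC else .plain s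

/-- Commitment randomness of an opened leaf. -/
def rnd (j : {j : Leaf D // j ≠ T.ch2}) : Rnd :=
  (S.leafOut T.rsp.salt (T.leafNode S j)).2

/-- Shares of an opened leaf. -/
def share (j : {j : Leaf D // j ≠ T.ch2}) : Share K L k r := S.shareOf (T.state S j)

/-- The `N` leaf commitments: recomputed for the opened leaves, received for the hidden one. -/
def cmts (j : Leaf D) : Cmt :=
  if h : j ≠ T.ch2 then S.com (T.state S ⟨j, h⟩) (T.rnd S ⟨j, h⟩) else T.rsp.cmt

/-- Shares of the main party `(d, b)`, summed over its opened leaves. These are all its leaves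
unless it contains the hidden leaf. -/
def mainShare (d : Fin D) (b : Bool) : Share K L k r :=
  Share.sum (Finset.univ.filter fun j : {j : Leaf D // j ≠ T.ch2} => j.1 d = b) (T.share S)

/-- Share of `α` of the main party `(d, b)`. It is the one computed from its input shares if all
its leaves are opened; otherwise it is the sum of the share of `α` received for the hidden leaf and
of those of its other leaves. The constant `y` is added by the last leaf, hence by the main parties
that contain it. -/
def mainAlpha (d : Fin D) (b : Bool) : Fin (r - 1) → L :=
  if T.ch2 d = b then
    T.rsp.α + ∑ j : {j : Leaf D // j ≠ T.ch2},
      if j.1 d = b then alphaShare q I T.ch1 (j.1 = lastLeaf D) (T.share S j) else 0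
  else alphaShare q I T.ch1 (b = true) (T.mainShare S d b)

/-- The value `α` opened in the execution of dimension `d`. -/
def alpha (d : Fin D) : Fin (r - 1) → L := ∑ b, T.mainAlpha S I q d b

/-- Share of `v` of the main party `(d, b)`. It is computed from its input shares if all its leaves
are opened; otherwise it is set so that the two shares of `v` sum to `0`. -/
def mainV (d : Fin D) (b : Bool) : L :=
  if T.ch2 d = b then -vShare q I T.ch1 ((!b) = true) (T.alpha S I q d) (T.mainShare S d (!b))
  else vShare q I T.ch1 (b = true) (T.alpha S I q d) (T.mainShare S d b)

/-- The hashed data of the execution of dimension `d`. -/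
def exec (d : Fin D) : (Bool → Fin (r - 1) → L) × (Bool → L) :=
  (T.mainAlpha S I q d, T.mainV S I q d)

/-- The hashes `(H_1, …, H_D)` recomputed by the verifier. -/
def execHashes (d : Fin D) : Dig := S.hashExec (T.exec S I q d)

/-- The decision of the verifier. -/
def Accepts : Prop :=
  S.hashCmts (T.cmts S) = T.h0 ∧
  (∀ d, ∑ b, T.mainV S I q d b = 0) ∧
  (∀ d d', T.alpha S I q d = T.alpha S I q d') ∧
  S.hashAll (T.execHashes S I q) = T.h1

end Transcript

end Verification

/-! ### Malicious provers -/

/-- A malicious prover: a distribution of random tapes and, for each tape, the three messages as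
functions of the challenges received so far. -/
structure Prover (K L : Type*) (n k r D : ℕ) (Seed Salt Cmt Dig Tape : Type*) where
  tape : PMF Tape
  commit : Tape → Dig
  respond1 : Tape → Ch1 L n k → Dig
  respond2 : Tape → Ch1 L n k → Leaf D → Response K L k r D Seed Salt Cmt

/-- The transcript of an execution with given tape and challenges. -/
def Prover.transcript {K L : Type*} {n k r D : ℕ} {Seed Salt Cmt Dig Tape : Type*}
    (P : Prover K L n k r D Seed Salt Cmt Dig Tape) (t : Tape) (ch1 : Ch1 L n k) (i : Leaf D) :
    Transcript K L n k r D Seed Salt Cmt Dig where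
  h0 := P.commit t
  ch1 := ch1
  h1 := P.respond1 t ch1
  ch2 := i
  rsp := P.respond2 t ch1 i

/-- Probability that the honest verifier, who samples both challenges uniformly, accepts. -/
def Prover.acceptProb {K L : Type*} [Field K] [Field L] [Algebra K L] [Fintype L]
    {n k r D : ℕ} {Seed Salt Rnd Cmt Dig Tape : Type*}
    (P : Prover K L n k r D Seed Salt Cmt Dig Tape)
    (S : Primitives K L k r D Seed Salt Rnd Cmt Dig) (I : Instance K n k) (q : ℕ) : ℝ :=
  ((P.tape.bind fun t =>
    (PMF.uniformOfFintype (Ch1 L n k)).bind fun ch1 =>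
      (PMF.uniformOfFintype (Leaf D)).map fun i =>
        P.transcript t ch1 i).toOuterMeasure {T | T.Accepts S I q}).toReal

/-! ### Outputs of the extractor -/

/-- Possible outputs: two openings of a leaf commitment, two inputs of the hash function, or a
vector. -/
inductive Output (K L : Type*) (n k r D : ℕ) (Seed Rnd Cmt Dig : Type*)
  | com (s s' : LeafState K L k r Seed) (ρ ρ' : Rnd)
  | hashCmts (u u' : Leaf D → Cmt)
  | hashExec (u u' : (Bool → Fin (r - 1) → L) × (Bool → L))
  | hashAll (u u' : Fin D → Dig)
  | witness (x : Coord n k → K)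

section Outputs

variable {K L : Type*} [Field K] [Field L] [Algebra K L] {n k r D : ℕ}
  {Seed Salt Rnd Cmt Dig : Type*}

/-- The output is a collision of the commitment scheme or of the hash function, or a good
witness. -/
def Output.Valid (F : Type*) [Field F] [Algebra F K] [Module.Finite F K]
    (S : Primitives K L k r D Seed Salt Rnd Cmt Dig) (I : Instance K n k) :
    Output K L n k r D Seed Rnd Cmt Dig → Prop
  | .com s s' ρ ρ' => s ≠ s' ∧ S.com s ρ = S.com s' ρ'
  | .hashCmts u u' => u ≠ u' ∧ S.hashCmts u = S.hashCmts u'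
  | .hashExec u u' => u ≠ u' ∧ S.hashExec u = S.hashExec u'
  | .hashAll u u' => u ≠ u' ∧ S.hashAll u = S.hashAll u'
  | .witness x => I.IsWitness F r x

open Classical in
/-- The candidate outputs that are read off from two transcripts `T`, `T'`: the openings of each
leaf opened in both, the three kinds of hash inputs and, if the hidden leaves differ, the vector
`(y - H' x_B ‖ x_B)`, where `x_B` is the sum of the shares of all leaves (that of the leaf hidden
in `T` is taken from `T'`). -/
def readOff (S : Primitives K L k r D Seed Salt Rnd Cmt Dig) (I : Instance K n k) (q : ℕ)
    (T T' : Transcript K L n k r D Seed Salt Cmt Dig) :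
    List (Output K L n k r D Seed Rnd Cmt Dig) :=
  ((Finset.univ : Finset {j : Leaf D // j ≠ T.ch2 ∧ j ≠ T'.ch2}).toList.map fun j =>
    .com (T.state S ⟨j.1, j.2.1⟩) (T'.state S ⟨j.1, j.2.2⟩)
      (T.rnd S ⟨j.1, j.2.1⟩) (T'.rnd S ⟨j.1, j.2.2⟩))
  ++ [.hashCmts (T.cmts S) (T'.cmts S)]
  ++ ((Finset.univ : Finset (Fin D)).toList.map fun d =>
    .hashExec (T.exec S I q d) (T'.exec S I q d))
  ++ [.hashAll (T.execHashes S I q) (T'.execHashes S I q)]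
  ++ (if h : T.ch2 ≠ T'.ch2 then
      [.witness (fullVec I True ((∑ j, (T.share S j).xB) + (T'.share S ⟨T.ch2, h⟩).xB))]
    else [])

end Outputs

/-! ### Extractors with rewindable access to the prover -/

/-- A call to the prover: one execution of the protocol with chosen challenges. Calls with the same
session label run the prover on the same random tape (rewinding); the first call of each session
draws a fresh tape. -/
structure Query (L : Type*) (n k D : ℕ) where
  session : ℕ
  ch1 : Ch1 L n k
  ch2 : Leaf D

/-- An extractor is given by its randomized choice of the next call, depending on its earlier calls
(latest first) and on whether each of them was accepted. It has no access to the random tapes. -/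
structure Extractor (L : Type*) (n k D : ℕ) where
  next : List (Query L n k D × Bool) → PMF (Query L n k D)

namespace Extractor

variable {K L : Type*} [Field K] [Field L] [Algebra K L] {n k r D : ℕ}
  {Seed Salt Rnd Cmt Dig Tape : Type*}
  (E : Extractor L n k D)
  (F : Type*) [Field F] [Fintype F] [Algebra F K] [Module.Finite F K]
  (S : Primitives K L k r D Seed Salt Rnd Cmt Dig) (I : Instance K n k)
  (P : Prover K L n k r D Seed Salt Cmt Dig Tape)

/-- The transcripts of a list of calls. -/
def transcripts (h : List (Query L n k D × Tape)) :
    List (Transcript K L n k r D Seed Salt Cmt Dig) :=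
  h.map fun c => P.transcript c.2 c.1.ch1 c.1.ch2

open Classical in
/-- After each call, the extractor tests all the candidates that can be read off from two of the
transcripts obtained so far; it halts with the first valid one as output. -/
def output (h : List (Query L n k D × Tape)) : Option (Output K L n k r D Seed Rnd Cmt Dig) :=
  ((transcripts P h).flatMap fun T => (transcripts P h).flatMap fun T' =>
    readOff S I (Fintype.card F) T T').find? fun o => decide (o.Valid F S I)

open Classical in
/-- One step of the interaction: nothing happens once the extractor has halted, otherwise it makes
one more call. -/
def step (h : List (Query L n k D × Tape)) : PMF (List (Query L n k D × Tape)) :=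
  if (output F S I P h).isSome then PMF.pure h
  else
    (E.next (h.map fun c : Query L n k D × Tape =>
        (c.1, decide ((P.transcript c.2 c.1.ch1 c.1.ch2).Accepts S I (Fintype.card F))))).bind
      fun qry =>
        (match h.find? (fun c : Query L n k D × Tape => decide (c.1.session = qry.session)) with
          | some c => PMF.pure c.2
          | none => P.tape).map fun t => (qry, t) :: h

/-- Distribution of the list of calls made by the extractor after `t` steps. -/
def run : ℕ → PMF (List (Query L n k D × Tape))
  | 0 => PMF.pure []
  | t + 1 => (run t).bind (E.step F S I P)

/-- Probability that within `t` calls the extractor has halted with a valid output. -/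
def successProb (t : ℕ) : ℝ≥0∞ :=
  (E.run F S I P t).toOuterMeasure {h | ∃ o, output F S I P h = some o ∧ o.Valid F S I}

/-- Expected total number of calls to the prover (the limit of the expected number of calls made
in the first `t` steps). -/
def expectedCalls : ℝ≥0∞ :=
  ⨆ t, ∑' h, E.run F S I P t h * (h.length : ℝ≥0∞)

end Extractor

/-- The false positive rate `p = 2 / q ^ (m η) - 1 / q ^ (2 m η)`. -/
def falsePositiveRate (q m η : ℕ) : ℝ := 2 / (q : ℝ) ^ (m * η) - 1 / (q : ℝ) ^ (2 * m * η)

/-- The soundness error `ε = p + (1 - p) / N`, with `N = 2 ^ D`. -/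
def soundnessError (q m η D : ℕ) : ℝ :=
  falsePositiveRate q m η + (1 - falsePositiveRate q m η) * (1 / (2 : ℝ) ^ D)

end RankSD

end

/-! Fix the random tape. Suppose two accepted executions with distinct hidden leaves yield no
output. They have the same `h0`, so the absence of collisions fixes the shares of every leaf for all
later accepted executions on this tape, and these shares add up to a vector `x` that is not a
witness. If two further accepted executions have the same first challenge `(γ, ε)` and hide distinct
leaves, then in a dimension where these leaves differ each main party is fully opened in one of the
two. Equality of the hashed data makes the shared computation honest there, and `v = 0`. But `v = -ε
∑ γ_j Q(x_j) - const`, where `Q` is an `F`-linear monic polynomial of degree `q ^ r` fixed by `β`.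
Its kernel has dimension at most `r`, so some `Q(x_j)` is nonzero, and `v = 0` confines the first
challenge to a set `G` of density at most `p` (`card_vValue_eq_zero_le`, `exists_confines`).

The extractor looks on a fresh tape for one pair, which fixes `G`, then on the same tape for a
second pair outside `G`. For this tape let `π` be the probability that one attempt finds a pair, `A`
its expected cost, and `e` a lower bound, valid for every `G` of density at most `p`, for the
probability of a pair outside `G`. The second search is entered with probability `π`, lasts until
success at expected cost at most `A / π`, and escapes `G` with probability at least `e / π`. Hence a
session costs at most `A + π * (A / π) = 2 A` and yields an output with probability at least `e`.

To bound `e`, let `W` be the part of the acceptance rate of a first challenge in excess of `1 / N`.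
Such a challenge contributes at least `W * (B W / (1 + B W))`, a convex function of `W`, which is
replaced by its tangent at `Δ = εt - ε`. The bound is then affine in the mean rate and can be
averaged over challenges and tapes (`avg_compl_ge`): `e` has mean at least `κ Δ / (1 + κ)` with `κ =
B Δ`, and `A` has mean at most `1 + B εt`. Twice the second over the first is `startPotential`, and
`B` close to `1 / Δ` gives the stated bound. All this is organised as a potential that drops by at
least one per call, which controls both the expected number of calls and the probability of halting.
-/

noncomputable section

set_option linter.unusedSectionVars false

/-! ### Calculus of expectations with values in `[0, ∞]`. -/

namespace PMF

/-- Expectation of an extended nonnegative function under a probability mass function. -/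
def lexp {α : Type*} (p : PMF α) (g : α → ℝ≥0∞) : ℝ≥0∞ := ∑' x, p x * g x

variable {α β : Type*}

theorem lexp_mono (p : PMF α) {g g' : α → ℝ≥0∞} (h : ∀ x, g x ≤ g' x) : p.lexp g ≤ p.lexp g' :=
  ENNReal.tsum_le_tsum fun x => mul_le_mul_right (h x) _

theorem lexp_const (p : PMF α) (a : ℝ≥0∞) : p.lexp (fun _ => a) = a := by
  simp [lexp, ENNReal.tsum_mul_right, p.tsum_coe]

theorem lexp_add (p : PMF α) (g g' : α → ℝ≥0∞) :
    p.lexp (fun x => g x + g' x) = p.lexp g + p.lexp g' := by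
  simp [lexp, mul_add, ENNReal.tsum_add]

theorem lexp_const_mul (p : PMF α) (a : ℝ≥0∞) (g : α → ℝ≥0∞) :
    p.lexp (fun x => a * g x) = a * p.lexp g := by
  simp only [lexp, ← ENNReal.tsum_mul_left]
  exact tsum_congr fun x => by ring

theorem lexp_pure (a : α) (g : α → ℝ≥0∞) : (PMF.pure a).lexp g = g a := by
  rw [lexp, tsum_eq_single a]
  · simp
  · intro b hb; simp [hb]

theorem lexp_bind (p : PMF α) (f : α → PMF β) (g : β → ℝ≥0∞) :
    (p.bind f).lexp g = p.lexp fun a => (f a).lexp g := by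
  simp only [lexp, PMF.bind_apply, ← ENNReal.tsum_mul_right, ← ENNReal.tsum_mul_left]
  rw [ENNReal.tsum_comm]
  exact tsum_congr fun a => tsum_congr fun b => by ring

theorem lexp_map (p : PMF α) (f : α → β) (g : β → ℝ≥0∞) :
    (p.map f).lexp g = p.lexp fun a => g (f a) := by
  rw [PMF.map, lexp_bind]
  simp [lexp_pure]

theorem lexp_uniform [Fintype α] [Nonempty α] (g : α → ℝ≥0∞) :
    (uniformOfFintype α).lexp g = (Fintype.card α : ℝ≥0∞)⁻¹ * ∑ x, g x := by
  simp [lexp, tsum_fintype, Finset.mul_sum]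

theorem lexp_uniform_ofReal [Fintype α] [Nonempty α] (g : α → ℝ) (hg : ∀ x, 0 ≤ g x) :
    (uniformOfFintype α).lexp (fun x => ENNReal.ofReal (g x))
      = ENNReal.ofReal ((∑ x, g x) / Fintype.card α) := by
  rw [lexp_uniform, ← ENNReal.ofReal_sum_of_nonneg fun x _ => hg x, div_eq_inv_mul,
    ENNReal.ofReal_mul (by positivity), ENNReal.ofReal_inv_of_pos (by positivity)]
  simp

open Classical in
theorem toOuterMeasure_eq_lexp (p : PMF α) (s : Set α) :
    p.toOuterMeasure s = p.lexp fun x => if x ∈ s then 1 else 0 := by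
  rw [toOuterMeasure_apply, lexp]
  exact tsum_congr fun x => by simp [Set.indicator_apply]

end PMF

/-! ### Halting and expected number of calls, from a decreasing potential. -/

namespace RankSD.Extractor

variable {K L : Type*} [Field K] [Field L] [Algebra K L] {n k r D : ℕ}
  {Seed Salt Rnd Cmt Dig Tape : Type*}
  (E : Extractor L n k D)
  (F : Type*) [Field F] [Fintype F] [Algebra F K] [Module.Finite F K]
  (S : Primitives K L k r D Seed Salt Rnd Cmt Dig) (I : Instance K n k)
  (P : Prover K L n k r D Seed Salt Cmt Dig Tape)

theorem valid_of_output_eq_some {h : List (Query L n k D × Tape)}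
    {o : Output K L n k r D Seed Rnd Cmt Dig} (ho : output F S I P h = some o) :
    o.Valid F S I := by
  classical
  have := List.find?_some ho
  simpa using this

theorem not_valid_of_output_eq_none {h : List (Query L n k D × Tape)}
    (ho : output F S I P h = none) {T T' : Transcript K L n k r D Seed Salt Cmt Dig}
    (hT : T ∈ transcripts P h) (hT' : T' ∈ transcripts P h)
    {o : Output K L n k r D Seed Rnd Cmt Dig} (hm : o ∈ readOff S I (Fintype.card F) T T') :
    ¬ o.Valid F S I := by
  classical
  rw [output, List.find?_eq_none] at ho
  have := ho o (List.mem_flatMap.2 ⟨T, hT, List.mem_flatMap.2 ⟨T', hT', hm⟩⟩)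
  simpa using this

open Classical in
/-- Probability of not having halted after `t` steps. -/
def runningProb (t : ℕ) : ℝ≥0∞ :=
  (E.run F S I P t).lexp fun h => if (output F S I P h).isSome then 0 else 1

/-- An output is tested for validity before it is returned, so halting and success coincide. -/
theorem successProb_add_runningProb (t : ℕ) :
    E.successProb F S I P t + E.runningProb F S I P t = 1 := by
  classical
  rw [successProb, PMF.toOuterMeasure_eq_lexp, runningProb, ← PMF.lexp_add]
  refine Eq.trans ?_ (PMF.lexp_const (E.run F S I P t) 1)
  congr 1; funext h
  rcases ho : output F S I P h with _ | o
  · simp [ho]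
  · have := valid_of_output_eq_some F S I P ho
    simp [ho, this]

theorem lexp_step_length (h : List (Query L n k D × Tape)) :
    (E.step F S I P h).lexp (fun h' => (h'.length : ℝ≥0∞))
      = h.length + if (output F S I P h).isSome then 0 else 1 := by
  classical
  unfold step
  split_ifs with ho
  · simp [PMF.lexp_pure]
  · simp [PMF.lexp_bind, PMF.lexp_map, PMF.lexp_const]

theorem lexp_run_length (t : ℕ) :
    (E.run F S I P t).lexp (fun h => (h.length : ℝ≥0∞))
      = ∑ s ∈ Finset.range t, E.runningProb F S I P s := by
  induction t with
  | zero => simp [run, PMF.lexp_pure]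
  | succ t ih =>
    rw [run, PMF.lexp_bind, Finset.sum_range_succ, ← ih, runningProb, ← PMF.lexp_add]
    congr 1; funext h
    rw [lexp_step_length]

/-- A potential that drops by at least one in expectation with each call bounds the expected number
of calls. -/
theorem lexp_run_length_le (Φ : List (Query L n k D × Tape) → ℝ≥0∞)
    (hΦ : ∀ h, output F S I P h = none → 1 + (E.step F S I P h).lexp Φ ≤ Φ h) (t : ℕ) :
    (E.run F S I P t).lexp (fun h => (h.length : ℝ≥0∞)) ≤ Φ [] := by
  have key : (E.run F S I P t).lexp (fun h => (h.length : ℝ≥0∞) + Φ h) ≤ Φ [] := by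
    induction t with
    | zero => simp [run, PMF.lexp_pure]
    | succ t ih =>
      refine le_trans ?_ ih
      rw [run, PMF.lexp_bind]
      refine PMF.lexp_mono _ fun h => ?_
      rcases ho : output F S I P h with _ | o
      · rw [PMF.lexp_add, lexp_step_length, ho]
        have := hΦ h ho
        simp only [Option.isSome_none, Bool.false_eq_true, if_false]
        rw [add_assoc]
        gcongr
      · simp [step, ho, PMF.lexp_pure]
  exact le_trans (PMF.lexp_mono _ fun h => le_self_add) key

theorem expectedCalls_le (Φ : List (Query L n k D × Tape) → ℝ≥0∞)
    (hΦ : ∀ h, output F S I P h = none → 1 + (E.step F S I P h).lexp Φ ≤ Φ h) :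
    E.expectedCalls F S I P ≤ Φ [] :=
  iSup_le fun t => lexp_run_length_le E F S I P Φ hΦ t

/-- The probabilities of still running sum to the expected number of calls; a finite sum forces them
to tend to `0`. -/
theorem tendsto_successProb (Φ : List (Query L n k D × Tape) → ℝ≥0∞)
    (hΦ : ∀ h, output F S I P h = none → 1 + (E.step F S I P h).lexp Φ ≤ Φ h)
    (hfin : Φ [] ≠ ∞) :
    Filter.Tendsto (fun t => E.successProb F S I P t) Filter.atTop (nhds 1) := by
  have hsum : ∑' t, E.runningProb F S I P t ≤ Φ [] := by
    rw [ENNReal.tsum_eq_iSup_nat]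
    refine iSup_le fun t => ?_
    rw [← lexp_run_length]
    exact lexp_run_length_le E F S I P Φ hΦ t
  have h0 := ENNReal.tendsto_atTop_zero_of_tsum_ne_top (ne_top_of_le_ne_top hfin hsum)
  have heq : (fun t => E.successProb F S I P t) = fun t => 1 - E.runningProb F S I P t := by
    funext t
    have h1 := successProb_add_runningProb E F S I P t
    refine ENNReal.eq_sub_of_add_eq ?_ h1
    exact ne_top_of_le_ne_top ENNReal.one_ne_top (h1 ▸ le_add_self)
  rw [heq]
  simpa using ENNReal.Tendsto.sub (tendsto_const_nhds (x := (1 : ℝ≥0∞))) h0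
    (Or.inl ENNReal.one_ne_top)

end RankSD.Extractor

namespace RankSD

/-! ### Expected cost of repeated sampling -/

/-- Expected cost of at most `f` independent trials of unit cost and success probability `W`, when
`out` is to be paid after a success and `fail` if all trials fail. -/
def trialCost (W out fail : ℝ) : ℕ → ℝ
  | 0 => fail
  | f + 1 => 1 + W * out + (1 - W) * trialCost W out fail f

theorem trialCost_eq (W out fail : ℝ) (f : ℕ) :
    trialCost W out fail f = ∑ j ∈ Finset.range f, (1 - W) ^ j + (1 - (1 - W) ^ f) * out
      + (1 - W) ^ f * fail := by
  induction f with
  | zero => simp [trialCost]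
  | succ f ih =>
    rw [trialCost, ih, Finset.sum_range_succ']
    simp only [pow_succ, ← Finset.sum_mul]
    ring

theorem trialCost_nonneg {W out fail : ℝ} (h0 : 0 ≤ W) (h1 : W ≤ 1) (ho : 0 ≤ out)
    (hf : 0 ≤ fail) (f : ℕ) : 0 ≤ trialCost W out fail f := by
  induction f with
  | zero => exact hf
  | succ f ih =>
    rw [trialCost]
    have : 0 ≤ 1 - W := by linarith
    positivity

/-- Bernoulli's inequality for `(1 + W) ^ B`, combined with `(1 + W) * (1 - W) ≤ 1`. -/
theorem div_le_one_sub_pow {W : ℝ} (h0 : 0 ≤ W) (h1 : W ≤ 1) (B : ℕ) :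
    B * W / (1 + B * W) ≤ 1 - (1 - W) ^ B := by
  have hB : 1 + B * W ≤ (1 + W) ^ B := one_add_mul_le_pow (by linarith) B
  have h2 : (1 + B * W) * (1 - W) ^ B ≤ 1 := by
    have h3 : 0 ≤ 1 - W := by linarith
    calc (1 + B * W) * (1 - W) ^ B ≤ (1 + W) ^ B * (1 - W) ^ B := by gcongr
      _ = (1 - W ^ 2) ^ B := by rw [← mul_pow]; ring_nf
      _ ≤ 1 := pow_le_one₀ (by nlinarith) (by nlinarith)
  have hpos : 0 < 1 + B * W := by positivity
  rw [div_le_iff₀ hpos]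
  linarith

/-- Slope of the tangent at `Δ` of the convex function `W ↦ B W ^ 2 / (1 + B W)`, where
`κ = B Δ`. -/
def tangentSlope (κ : ℝ) : ℝ := κ * (2 + κ) / (1 + κ) ^ 2

/-- Minus the value at `0` of the tangent at `Δ` of `W ↦ B W ^ 2 / (1 + B W)`. -/
def tangentOffset (κ Δ : ℝ) : ℝ := κ * Δ / (1 + κ) ^ 2

/-- The gap to the tangent is an explicit nonnegative multiple of `(W - Δ) ^ 2`. -/
theorem tangent_le {B Δ W : ℝ} (hB : 0 ≤ B) (hΔ : 0 ≤ Δ) (hW : 0 ≤ W) :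
    tangentSlope (B * Δ) * W - tangentOffset (B * Δ) Δ ≤ W * (B * W / (1 + B * W)) := by
  have h1 : 0 < 1 + B * Δ := by positivity
  have h2 : 0 < 1 + B * W := by positivity
  have key : W * (B * W / (1 + B * W)) -
      (tangentSlope (B * Δ) * W - tangentOffset (B * Δ) Δ)
      = B * (W - Δ) ^ 2 / ((1 + B * W) * (1 + B * Δ) ^ 2) := by
    unfold tangentSlope tangentOffset
    field_simp
    ring
  have : 0 ≤ B * (W - Δ) ^ 2 / ((1 + B * W) * (1 + B * Δ) ^ 2) := by positivity
  linarith

theorem tangent_at {κ Δ : ℝ} (hκ : 0 ≤ κ) :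
    tangentSlope κ * Δ - tangentOffset κ Δ = κ * Δ / (1 + κ) := by
  have : 0 < 1 + κ := by positivity
  unfold tangentSlope tangentOffset
  field_simp
  ring

/-! ### Acceptance rates of the two challenges -/

section Rates

variable {C J : Type*} [Fintype J] (acc : C → J → Prop)

open Classical in
/-- Proportion of the second challenges accepted after the first challenge `c`. -/
def rate (c : C) : ℝ := ((Finset.univ.filter (acc c)).card : ℝ) / Fintype.card J

/-- Proportion of the second challenges accepted after the first challenge `c` besides a given
accepted one. -/
def otherRate (c : C) : ℝ := max (rate acc c - 1 / Fintype.card J) 0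

variable {acc}

theorem rate_nonneg (c : C) : 0 ≤ rate acc c := by unfold rate; positivity

theorem rate_le_one (c : C) : rate acc c ≤ 1 := by
  classical
  unfold rate
  refine div_le_one_of_le₀ ?_ (by positivity)
  exact_mod_cast Finset.card_le_univ _

theorem otherRate_nonneg (c : C) : 0 ≤ otherRate acc c := le_max_right _ _

theorem otherRate_le_rate (c : C) : otherRate acc c ≤ rate acc c :=
  max_le (sub_le_self _ (by positivity)) (rate_nonneg c)

theorem otherRate_le_one (c : C) : otherRate acc c ≤ 1 :=
  (otherRate_le_rate c).trans (rate_le_one c)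

theorem one_sub_pow_nonneg (c : C) (B : ℕ) : 0 ≤ 1 - (1 - otherRate acc c) ^ B :=
  sub_nonneg.2 (pow_le_one₀ (sub_nonneg.2 (otherRate_le_one c))
    (sub_le_self _ (otherRate_nonneg c)))

theorem otherRate_pos [Nonempty J] {c : C} {i j : J} (hi : acc c i) (hj : acc c j) (hij : i ≠ j) :
    0 < otherRate acc c := by
  classical
  refine lt_max_of_lt_left (sub_pos.2 ?_)
  unfold rate
  gcongr
  have : 1 < (Finset.univ.filter (acc c)).card :=
    Finset.one_lt_card.2 ⟨i, by simpa using hi, j, by simpa using hj, hij⟩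
  exact_mod_cast this

open Classical in
theorem sum_acc_div [Nonempty J] (c : C) (x y : ℝ) :
    (∑ i, if acc c i then x else y) / Fintype.card J = rate acc c * x + (1 - rate acc c) * y := by
  have hc : ((Finset.univ.filter fun i => ¬ acc c i).card : ℝ)
      = Fintype.card J - (Finset.univ.filter (acc c)).card := by
    rw [eq_sub_iff_add_eq, ← Nat.cast_add, add_comm, Finset.card_filter_add_card_filter_not]
    simp
  rw [Finset.sum_ite, Finset.sum_const, Finset.sum_const, nsmul_eq_mul, nsmul_eq_mul, hc]
  unfold rate
  field_simp

open Classical in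
theorem sum_acc_ne_div [Nonempty J] [DecidableEq J] {c : C} {i : J} (hi : acc c i) (x y : ℝ) :
    (∑ j, if acc c j ∧ j ≠ i then x else y) / Fintype.card J
      = otherRate acc c * x + (1 - otherRate acc c) * y := by
  have h : ∀ j, (if acc c j ∧ j ≠ i then x else y)
      = (if acc c j then x else y) - if j = i then x - y else 0 := by
    intro j
    by_cases hj : j = i
    · subst hj; simp [hi]
    · simp [hj]
  -- The leaf `i` is itself accepted, so the rate is at least `1 / |J|` and the truncation at `0` is
  -- inactive.
  have hW : otherRate acc c = rate acc c - 1 / Fintype.card J := by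
    refine max_eq_left (sub_nonneg.2 ?_)
    unfold rate
    gcongr
    exact_mod_cast Finset.card_pos.2 ⟨i, by simpa using hi⟩
  simp_rw [h]
  rw [Finset.sum_sub_distrib, sub_div, sum_acc_div, hW]
  simp
  ring

variable [Fintype C]

/-- Average over the first challenge. -/
def avg (f : C → ℝ) : ℝ := (∑ c, f c) / Fintype.card C

variable (acc) in
/-- Probability that uniform challenges are accepted. -/
def meanRate : ℝ := avg (rate acc)

variable (acc) in
/-- Probability that a uniform pair of challenges is accepted, and that one of at most `B`
repetitions with the same first challenge is accepted with another second challenge. -/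
def pairProb (B : ℕ) : ℝ := avg fun c => rate acc c * (1 - (1 - otherRate acc c) ^ B)

variable (acc) in
/-- Expected number of calls of the experiment of `pairProb`. -/
def attemptCost (B : ℕ) : ℝ :=
  1 + avg fun c => rate acc c * ∑ j ∈ Finset.range B, (1 - otherRate acc c) ^ j

theorem avg_add (f g : C → ℝ) : avg (fun c => f c + g c) = avg f + avg g := by
  simp [avg, Finset.sum_add_distrib, add_div]

theorem avg_sub (f g : C → ℝ) : avg (fun c => f c - g c) = avg f - avg g := by
  simp [avg, Finset.sum_sub_distrib, sub_div]

theorem avg_mul_const (f : C → ℝ) (a : ℝ) : avg (fun c => f c * a) = avg f * a := by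
  simp [avg, ← Finset.sum_mul]; ring

theorem avg_const [Nonempty C] (a : ℝ) : avg (fun _ : C => a) = a := by
  simp [avg]

theorem avg_mono {f g : C → ℝ} (h : ∀ c, f c ≤ g c) : avg f ≤ avg g := by
  unfold avg
  gcongr with c
  exact h c

theorem avg_nonneg {f : C → ℝ} (h : ∀ c, 0 ≤ f c) : 0 ≤ avg f :=
  div_nonneg (Finset.sum_nonneg fun c _ => h c) (by positivity)

theorem meanRate_nonneg : 0 ≤ meanRate acc := avg_nonneg rate_nonneg

theorem meanRate_le_one [Nonempty C] : meanRate acc ≤ 1 :=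
  (avg_mono rate_le_one).trans_eq (avg_const 1)

theorem pairProb_nonneg (B : ℕ) : 0 ≤ pairProb acc B :=
  avg_nonneg fun c => mul_nonneg (rate_nonneg c) (one_sub_pow_nonneg c B)

theorem attemptCost_nonneg (B : ℕ) : 0 ≤ attemptCost acc B :=
  add_nonneg zero_le_one (avg_nonneg fun c => mul_nonneg (rate_nonneg c)
    (Finset.sum_nonneg fun _ _ => pow_nonneg (sub_nonneg.2 (otherRate_le_one c)) _))

theorem attemptCost_le (B : ℕ) : attemptCost acc B ≤ 1 + meanRate acc * B := by
  unfold attemptCost meanRate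
  rw [← avg_mul_const]
  gcongr
  refine avg_mono fun c => mul_le_mul_of_nonneg_left ?_ (rate_nonneg c)
  calc _ ≤ ∑ j ∈ Finset.range B, (1 : ℝ) := Finset.sum_le_sum fun _ _ =>
        pow_le_one₀ (sub_nonneg.2 (otherRate_le_one c)) (sub_le_self _ (otherRate_nonneg c))
    _ = B := by simp

theorem pairProb_pos [Nonempty J] {B : ℕ} (hB : B ≠ 0) {c : C} {i j : J} (hi : acc c i)
    (hj : acc c j) (hij : i ≠ j) : 0 < pairProb acc B := by
  have hW := otherRate_pos hi hj hij
  have : Nonempty C := ⟨c⟩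
  refine div_pos (Finset.sum_pos' (fun c _ => mul_nonneg (rate_nonneg c) (one_sub_pow_nonneg c B))
    ⟨c, Finset.mem_univ c, mul_pos (hW.trans_le (otherRate_le_rate c)) (sub_pos.2 ?_)⟩)
    (by positivity)
  exact pow_lt_one₀ (sub_nonneg.2 (otherRate_le_one c)) (sub_lt_self _ hW) hB

/-- The pairs found outside a small set of first challenges. -/
theorem avg_compl_ge [Nonempty C] [Nonempty J] {p Δ : ℝ} (hΔ : 0 ≤ Δ) (B : ℕ) {G : Finset C}
    (hG : (G.card : ℝ) ≤ p * Fintype.card C) :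
    tangentSlope (B * Δ) * (meanRate acc - (p + (1 - p) * (1 / Fintype.card J)))
        - tangentOffset (B * Δ) Δ
      ≤ pairProb acc B - avg fun c => (G : Set C).indicator
          (fun c => rate acc c * (1 - (1 - otherRate acc c) ^ B)) c := by
  classical
  set σ := tangentSlope (B * Δ)
  set τ := tangentOffset (B * Δ) Δ
  set ν : ℝ := 1 / Fintype.card J
  have hν0 : 0 ≤ ν := by positivity
  have hν1 : ν ≤ 1 := by
    refine div_le_one_of_le₀ ?_ (by positivity)
    exact_mod_cast Fintype.card_pos
  have hσ : 0 ≤ σ := by unfold σ tangentSlope; positivity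
  have hτ : 0 ≤ τ := by unfold τ tangentOffset; positivity
  rw [pairProb, ← avg_sub]
  -- On `G` the right side is `0`, and the correction `σ (1 - ν)` makes the left side nonpositive
  -- because the rate is at most `1`. Off `G`, chain `rate - ν ≤ W`, the tangent, Bernoulli and `W ≤
  -- rate`. On average the correction costs at most `p σ (1 - ν)`, which turns the threshold `ν`
  -- into `p + (1 - p) ν`.
  have hc : ∀ c, σ * (rate acc c - ν) - τ - (G : Set C).indicator (fun _ => σ * (1 - ν)) c
      ≤ rate acc c * (1 - (1 - otherRate acc c) ^ B) - (G : Set C).indicator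
          (fun c => rate acc c * (1 - (1 - otherRate acc c) ^ B)) c := by
    intro c
    by_cases hcG : c ∈ G
    · simp only [Set.indicator, Finset.mem_coe, hcG, if_true, sub_self]
      have := mul_le_mul_of_nonneg_left (rate_le_one (acc := acc) c) hσ
      nlinarith
    · simp only [Set.indicator, Finset.mem_coe, hcG, if_false, sub_zero]
      have h1 := tangent_le (B := B) (by positivity) hΔ (otherRate_nonneg (acc := acc) c)
      have h2 := div_le_one_sub_pow (otherRate_nonneg (acc := acc) c) (otherRate_le_one c) B
      have h3 : σ * (rate acc c - ν) ≤ σ * otherRate acc c :=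
        mul_le_mul_of_nonneg_left (le_max_left _ _) hσ
      have h4 := mul_le_mul_of_nonneg_left h2 (otherRate_nonneg (acc := acc) c)
      have h5 := mul_le_mul_of_nonneg_right (otherRate_le_rate (acc := acc) c)
        (one_sub_pow_nonneg (acc := acc) c B)
      linarith
  refine le_trans ?_ (avg_mono hc)
  have e1 : avg (fun c => σ * (rate acc c - ν) - τ) = σ * (meanRate acc - ν) - τ := by
    simp_rw [mul_comm σ]
    rw [avg_sub, avg_mul_const, avg_sub, avg_const, avg_const, meanRate]
  have e2 : avg (fun c => (G : Set C).indicator (fun _ => σ * (1 - ν)) c)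
      = G.card / Fintype.card C * (σ * (1 - ν)) := by
    simp [avg, Set.indicator, Finset.sum_ite_mem]
    ring
  have e3 : (G.card : ℝ) / Fintype.card C ≤ p := by
    rw [div_le_iff₀ (by exact_mod_cast Fintype.card_pos)]
    exact hG
  rw [avg_sub, e1, e2]
  have := mul_le_mul_of_nonneg_right e3 (mul_nonneg hσ (sub_nonneg.2 hν1))
  linarith

end Rates

/-! ### Potentials of the states of the extractor, for a fixed random tape -/

section Potential

variable {C J : Type*} [Fintype C] [Fintype J] (acc : C → J → Prop)

/-- Lower bound for the probability of finding a pair outside a small set of first challenges. -/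
def escapeProb (B : ℕ) (p Δ : ℝ) : ℝ :=
  max 0 (tangentSlope (B * Δ) * (meanRate acc - (p + (1 - p) * (1 / Fintype.card J)))
    - tangentOffset (B * Δ) Δ)

/-- Potential after a first pair has been found, when `V` is the potential at the start. -/
def pairPotential (B : ℕ) (p Δ V : ℝ) : ℝ :=
  (attemptCost acc B + (pairProb acc B - escapeProb acc B p Δ) * V) / pairProb acc B

variable {acc}

/-- The bound does not depend on `G`. This allows the potential of the second search to be defined
before the first pair has determined `G`. -/
theorem avg_indicator_le [Nonempty C] [Nonempty J] {p Δ : ℝ} (hΔ : 0 ≤ Δ) (B : ℕ) {G : Finset C}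
    (hG : (G.card : ℝ) ≤ p * Fintype.card C) :
    (avg fun c => (G : Set C).indicator
        (fun c => rate acc c * (1 - (1 - otherRate acc c) ^ B)) c)
      ≤ pairProb acc B - escapeProb acc B p Δ := by
  rw [le_sub_comm]
  refine max_le (sub_nonneg.2 ?_) (avg_compl_ge hΔ B hG)
  refine avg_mono fun c => Set.indicator_le_self' (fun _ _ => ?_) c
  exact mul_nonneg (rate_nonneg _) (one_sub_pow_nonneg _ B)

theorem escapeProb_le [Nonempty C] [Nonempty J] {p Δ : ℝ} (hΔ : 0 ≤ Δ) (hp : 0 ≤ p) (B : ℕ) :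
    escapeProb acc B p Δ ≤ pairProb acc B := by
  have := avg_indicator_le (acc := acc) (G := ∅) (p := p) hΔ B (by simp; positivity)
  simpa [avg] using this

theorem pairPotential_nonneg [Nonempty C] [Nonempty J] {p Δ V : ℝ} (hΔ : 0 ≤ Δ) (hp : 0 ≤ p)
    (hV : 0 ≤ V) (B : ℕ) : 0 ≤ pairPotential acc B p Δ V :=
  div_nonneg (add_nonneg (attemptCost_nonneg B)
    (mul_nonneg (sub_nonneg.2 (escapeProb_le hΔ hp B)) hV)) (pairProb_nonneg B)

/-- A failed attempt comes back to potential `fail`, so the change is the cost of the attempt, plus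
`out` minus `fail` whenever a pair is found. -/
theorem avg_trialCost (B : ℕ) (out : C → ℝ) (fail : ℝ) [Nonempty C] :
    1 + avg (fun c => rate acc c * trialCost (otherRate acc c) (out c) fail B
        + (1 - rate acc c) * fail)
      = fail + attemptCost acc B
        + avg (fun c => rate acc c * (1 - (1 - otherRate acc c) ^ B) * out c)
        - pairProb acc B * fail := by
  have h : ∀ c, rate acc c * trialCost (otherRate acc c) (out c) fail B
        + (1 - rate acc c) * fail
      = rate acc c * ∑ j ∈ Finset.range B, (1 - otherRate acc c) ^ j
        + rate acc c * (1 - (1 - otherRate acc c) ^ B) * out c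
        + (fail - rate acc c * (1 - (1 - otherRate acc c) ^ B) * fail) := by
    intro c
    rw [trialCost_eq]
    ring
  simp_rw [h]
  rw [avg_add, avg_add, avg_sub, avg_const, avg_mul_const, pairProb, attemptCost]
  ring

/-- With `π`, `A`, `e` as above, `pairPotential` solves `U = A + (π - e) V + (1 - π) U`: a pair
inside `G`, of probability at most `π - e`, leads back to the start, and a pair outside `G` ends the
search. -/
theorem pairPotential_step [Nonempty C] [Nonempty J] {p Δ V : ℝ} (hΔ : 0 ≤ Δ) (hV : 0 ≤ V)
    {B : ℕ} {G : Finset C} (hG : (G.card : ℝ) ≤ p * Fintype.card C) (hπ : 0 < pairProb acc B) :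
    1 + avg (fun c => rate acc c * trialCost (otherRate acc c)
        ((G : Set C).indicator (fun _ => V) c) (pairPotential acc B p Δ V) B + (1 - rate acc c) * pairPotential acc B p Δ V)
      ≤ pairPotential acc B p Δ V := by
  rw [avg_trialCost]
  have h1 : avg (fun c => rate acc c * (1 - (1 - otherRate acc c) ^ B)
        * (G : Set C).indicator (fun _ => V) c)
      = (avg fun c => (G : Set C).indicator
        (fun c => rate acc c * (1 - (1 - otherRate acc c) ^ B)) c) * V := by
    rw [← avg_mul_const]
    congr 1; funext c
    by_cases hc : c ∈ G <;> simp [hc]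
  have h2 : pairProb acc B * pairPotential acc B p Δ V
      = attemptCost acc B + (pairProb acc B - escapeProb acc B p Δ) * V := by
    unfold pairPotential
    field_simp
  rw [h1, h2]
  have := mul_le_mul_of_nonneg_right (avg_indicator_le (acc := acc) hΔ B hG) hV
  linarith

/-- Since `π U = A + (π - e) V` for `U = pairPotential`, the factor `1 / π` in the cost of the
second search cancels against the probability of entering it. -/
theorem startPotential_step [Nonempty C] [Nonempty J] {p Δ V : ℝ} (hΔ : 0 ≤ Δ) (hp : 0 ≤ p)
    (B : ℕ) :
    1 + avg (fun c => rate acc c * trialCost (otherRate acc c) (pairPotential acc B p Δ V) V B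
        + (1 - rate acc c) * V)
      ≤ V + 2 * attemptCost acc B - escapeProb acc B p Δ * V := by
  rw [avg_trialCost, avg_mul_const]
  change _ + pairProb acc B * _ - _ ≤ _
  have hle := escapeProb_le (acc := acc) hΔ hp B
  -- If `π = 0` the quotient defining `pairPotential` is `0` by convention; then `e = 0` too, and
  -- the inequality reduces to `0 ≤ A`.
  rcases (pairProb_nonneg (acc := acc) B).eq_or_lt with h0 | hpos
  · have : escapeProb acc B p Δ = 0 := le_antisymm (by rw [h0]; exact hle) (le_max_left _ _)
    rw [← h0, this]
    have := attemptCost_nonneg (acc := acc) B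
    linarith
  · have h2 : pairProb acc B * pairPotential acc B p Δ V
        = attemptCost acc B + (pairProb acc B - escapeProb acc B p Δ) * V := by
      unfold pairPotential
      field_simp
    rw [h2]
    linarith

end Potential

/-! ### Choice of the number of repetitions -/

/-- Number of repetitions with the same first challenge, for an advantage `Δ`. -/
def repetitions (Δ : ℝ) : ℕ := if 1 / 2 ≤ Δ then 1 else ⌈1 / Δ⌉₊

theorem repetitions_pos {Δ : ℝ} (hΔ : 0 < Δ) : 0 < repetitions Δ := by
  unfold repetitions
  split_ifs
  · exact one_pos
  · exact Nat.ceil_pos.2 (by positivity)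

/-- Expected number of calls of the extractor. -/
def startPotential (B : ℕ) (Δ εt : ℝ) : ℝ := 2 * (1 + εt * B) * (1 + B * Δ) / (B * Δ * Δ)

theorem startPotential_le {Δ εt : ℝ} (hΔ : 0 < Δ) (hΔ1 : Δ ≤ 1) (hε : Δ ≤ εt) :
    startPotential (repetitions Δ) Δ εt
      ≤ 4 / Δ * (1 + 2 * εt * Real.log 2 / Δ) := by
  have hlog := Real.log_two_gt_d9
  have hεpos : 0 < εt := hΔ.trans_le hε
  have hB : (0 : ℝ) < repetitions Δ := by exact_mod_cast repetitions_pos hΔ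
  set B : ℝ := (repetitions Δ : ℝ) with hBdef
  -- After clearing `Δ ^ 2` the claim requires the constant `4 log 2 - 1`, which is just above
  -- `1.77`. For `Δ < 1 / 2`, rounding up gives `B Δ < 1 + Δ < 3 / 2`.
  have key : 1 / B + εt * (B * Δ) ≤ Δ + 1.77 * εt := by
    by_cases h : 1 / 2 ≤ Δ
    · have hB1 : B = 1 := by rw [hBdef, repetitions, if_pos h, Nat.cast_one]
      rw [hB1]
      nlinarith [mul_nonneg (sub_nonneg.2 hε) (sub_nonneg.2 hΔ1)]
    · have hBc : B = (⌈1 / Δ⌉₊ : ℝ) := by rw [hBdef, repetitions, if_neg h]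
      have h1 : 1 / Δ ≤ B := hBc ▸ Nat.le_ceil _
      have h2 : B < 1 / Δ + 1 := hBc ▸ Nat.ceil_lt_add_one (by positivity)
      have h3 : 1 / B ≤ Δ := by
        rw [div_le_iff₀ hΔ] at h1
        rw [div_le_iff₀ hB]; linarith
      have h4 : B * Δ ≤ 1.77 := by
        have : B * Δ < (1 / Δ + 1) * Δ := by gcongr
        have e : (1 / Δ + 1) * Δ = 1 + Δ := by field_simp
        rw [e] at this
        push Not at h
        linarith
      have h5 := mul_le_mul_of_nonneg_left h4 hεpos.le
      linarith
  have e : startPotential (repetitions Δ) Δ εt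
      = 2 * (1 / B + εt * (B * Δ) + Δ + εt) / Δ ^ 2 := by
    unfold startPotential
    rw [← hBdef]
    field_simp
    ring
  have e2 : 4 / Δ * (1 + 2 * εt * Real.log 2 / Δ)
      = 2 * (2 * Δ + 4 * Real.log 2 * εt) / Δ ^ 2 := by
    field_simp
    ring
  rw [e, e2]
  gcongr 2 * ?_ / _
  nlinarith

/-! ### Rank weight and `q`-polynomials -/

section QPoly

variable (F : Type*) {K : Type*} [Field F] [Fintype F] [Field K] [Algebra F K]

/-- The `q`-polynomial `X ^ (q ^ r) - X + ∑ e, β e (X ^ (q ^ (e + 1)) - X)`, as a linear map. -/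
def qPoly {s : ℕ} (r : ℕ) (β : Fin s → K) : K →ₗ[F] K :=
  (FiniteField.frobeniusAlgHom F K ^ r).toLinearMap - LinearMap.id
    + ∑ e, LinearMap.mulLeft F (β e) ∘ₗ
      ((FiniteField.frobeniusAlgHom F K ^ (e.val + 1)).toLinearMap - LinearMap.id)

theorem frobeniusAlgHom_pow_apply (e : ℕ) (x : K) :
    (FiniteField.frobeniusAlgHom F K ^ e) x = x ^ Fintype.card F ^ e := by
  rw [AlgHom.coe_pow, FiniteField.coe_frobeniusAlgHom, pow_iterate]

theorem qPoly_apply {s : ℕ} (r : ℕ) (β : Fin s → K) (x : K) :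
    qPoly F r β x = x ^ Fintype.card F ^ r - x
      + ∑ e, β e * (x ^ Fintype.card F ^ (e.val + 1) - x) := by
  simp [qPoly, frobeniusAlgHom_pow_apply]

open Polynomial in
-- The map is evaluation of a monic polynomial of degree `q ^ r`: its kernel has at most `q ^ r`
-- elements, and exactly `q` to the power of its dimension.
theorem finrank_ker_qPoly_le [Finite K] {r : ℕ} (hr : 1 ≤ r) (β : Fin (r - 1) → K) :
    Module.finrank F (LinearMap.ker (qPoly F r β)) ≤ r := by
  classical
  have := Fintype.ofFinite K
  set q := Fintype.card F
  have hq : 1 < q := Fintype.one_lt_card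
  set f : K[X] := ∑ e, C (β e) * (X ^ q ^ (e.val + 1) - X) - X with hf
  have hfdeg : f.degree < (q ^ r : ℕ) := by
    have hX : (X : K[X]).degree < (q ^ r : ℕ) := by
      rw [degree_X]
      exact_mod_cast Nat.one_lt_pow (by omega) hq
    refine (degree_sub_le _ _).trans_lt (max_lt ?_ hX)
    refine (degree_sum_le _ _).trans_lt ((Finset.sup_lt_iff ?_).2 fun e _ => ?_)
    · exact WithBot.bot_lt_coe _
    · rw [← smul_eq_C_mul]
      refine (degree_smul_le _ _).trans_lt ((degree_sub_le _ _).trans_lt (max_lt ?_ hX))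
      rw [degree_X_pow]
      exact_mod_cast Nat.pow_lt_pow_right hq (by omega)
  have hmonic : (X ^ q ^ r + f).Monic := monic_X_pow_add hfdeg
  have hdeg : (X ^ q ^ r + f).natDegree = q ^ r :=
    by
    rw [natDegree_add_eq_left_of_degree_lt (by rwa [degree_X_pow]), natDegree_X_pow]
  have heval : ∀ x, (X ^ q ^ r + f).eval x = qPoly F r β x := by
    intro x
    rw [qPoly_apply]
    simp only [hf, eval_add, eval_sub, eval_pow, eval_X, eval_finsetSum, eval_mul, eval_C]
    ring
  have hcard : Nat.card (LinearMap.ker (qPoly F r β)) ≤ q ^ r := by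
    rw [Nat.card_eq_fintype_card, ← hdeg]
    refine le_trans ?_ ((Multiset.toFinset_card_le _).trans (card_roots' (X ^ q ^ r + f)))
    rw [Fintype.card_subtype]
    refine Finset.card_le_card fun x hx => ?_
    rw [Multiset.mem_toFinset, mem_roots hmonic.ne_zero, IsRoot, heval]
    simpa using hx
  rw [Module.natCard_eq_pow_finrank (K := F), Nat.card_eq_fintype_card] at hcard
  exact (Nat.pow_le_pow_iff_right hq).1 hcard

/-- The rows of the coordinate matrix lie in the image of `M` under the coordinate isomorphism. -/
theorem rankWeight_le_finrank [Module.Finite F K] {ι : Type*} [Finite ι] (x : ι → K)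
    (M : Submodule F K) (hx : ∀ i, x i ∈ M) : rankWeight F x ≤ Module.finrank F M := by
  rw [rankWeight, Matrix.rank_eq_finrank_span_row]
  set e := (Module.finBasis F K).equivFun
  have hle : Submodule.span F (Set.range (Matrix.of fun i j =>
      (Module.finBasis F K).repr (x i) j).row) ≤ M.map e.toLinearMap := by
    rw [Submodule.span_le]
    rintro _ ⟨i, rfl⟩
    exact ⟨x i, hx i, rfl⟩
  refine (Submodule.finrank_mono hle).trans ?_
  exact Submodule.finrank_map_le _ _

end QPoly

/-! ### The false positive rate -/

section Count

open Classical in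
-- A nonzero linear form is surjective, and all fibres of a surjective homomorphism have the same
-- size.
theorem card_linear_fiber {L ι : Type*} [Field L] [Fintype L] [Fintype ι]
    [DecidableEq ι] (y : ι → L) (hy : y ≠ 0) (u : L) :
    Fintype.card L * (Finset.univ.filter fun γ : ι → L => ∑ j, γ j * y j = u).card
      = Fintype.card (ι → L) := by
  obtain ⟨j₀, hj₀⟩ := Function.ne_iff.1 hy
  let ℓ : (ι → L) →+ L :=
    { toFun := fun γ => ∑ j, γ j * y j
      map_zero' := by simp
      map_add' := fun a b => by simp [add_mul, Finset.sum_add_distrib] }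
  have hsurj : ∀ v, v ∈ Set.range ℓ := fun v => by
    refine ⟨Pi.single j₀ (v / y j₀), ?_⟩
    change ∑ j, (Pi.single j₀ (v / y j₀) : ι → L) j * y j = v
    rw [Finset.sum_eq_single j₀]
    · simpa using div_mul_cancel₀ v hj₀
    · intro b _ hb; simp [hb]
    · simp
  have h := Finset.card_eq_sum_card_fiberwise (f := fun γ : ι → L => ∑ j, γ j * y j)
    (s := Finset.univ) (t := Finset.univ) (fun _ _ => Finset.mem_coe.2 (Finset.mem_univ _))
  rw [Finset.card_univ] at h
  have hfib : ∀ v ∈ Finset.univ, (Finset.univ.filter fun γ : ι → L => ∑ j, γ j * y j = v).card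
      = (Finset.univ.filter fun γ : ι → L => ∑ j, γ j * y j = u).card :=
    fun v _ => AddMonoidHom.card_fiber_eq_of_mem_range ℓ (hsurj v) (hsurj u)
  rw [h, Finset.sum_congr rfl hfib]
  simp

open Classical in
-- Write `Q = |L|` and `M` for the number of vectors `γ`. The scalar `0` admits at most `M` of them,
-- and each of the other `Q - 1` scalars admits `M / Q`, since it can be divided out.
theorem card_false_positive_le {L ι : Type*} [Field L] [Fintype L] [Fintype ι]
    [DecidableEq ι] (y : ι → L) (hy : y ≠ 0) (u : L) :
    ((Finset.univ.filter fun ch : (ι → L) × L => ch.2 * ∑ j, ch.1 j * y j = u).card : ℝ)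
      ≤ (2 / Fintype.card L - 1 / (Fintype.card L : ℝ) ^ 2) * Fintype.card ((ι → L) × L) := by
  set Q : ℝ := (Fintype.card L : ℝ) with hQ
  set M : ℝ := (Fintype.card (ι → L) : ℝ) with hM
  have hQ0 : 0 < Q := by rw [hQ]; exact_mod_cast Fintype.card_pos
  have hsum : (Finset.univ.filter fun ch : (ι → L) × L => ch.2 * ∑ j, ch.1 j * y j = u).card
      = ∑ e : L, (Finset.univ.filter fun γ : ι → L => e * ∑ j, γ j * y j = u).card := by
    simp only [Finset.card_filter, Fintype.sum_prod_type]
    exact Finset.sum_comm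
  have hfib : ∀ e : L, ((Finset.univ.filter fun γ : ι → L =>
      e * ∑ j, γ j * y j = u).card : ℝ) ≤ if e = 0 then M else M / Q := by
    intro e
    split_ifs with he
    · rw [hM]; exact_mod_cast Finset.card_le_univ _
    · rw [le_div_iff₀ hQ0, hM, ← card_linear_fiber y hy (u / e), mul_comm]
      push_cast
      refine mul_le_mul_of_nonneg_left ?_ hQ0.le
      refine Nat.cast_le.2 (Finset.card_le_card (Finset.monotone_filter_right _ fun γ _ h => ?_))
      rw [eq_div_iff he, mul_comm]; exact h
  rw [hsum, Nat.cast_sum]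
  refine (Finset.sum_le_sum fun e _ => hfib e).trans (le_of_eq ?_)
  have h1 : ∀ e : L, (if e = 0 then M else M / Q) = M / Q + if e = 0 then M - M / Q else 0 := by
    intro e; split_ifs <;> ring
  simp_rw [h1]
  rw [Finset.sum_add_distrib]
  simp only [Finset.sum_const, Finset.card_univ, nsmul_eq_mul, Finset.sum_ite_eq',
    Finset.mem_univ, if_true, Fintype.card_prod, Nat.cast_mul, ← hQ, ← hM]
  field_simp
  ring

end Count

/-! ### Linearity of the computation on shares -/

section Linear

variable {F K L : Type*} [Field F] [Field K] [Algebra F K] [Field L] [Algebra K L] {n k r : ℕ}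

theorem fullVec_isWitness_iff [Module.Finite F K] (I : Instance K n k) (xB : Fin k → K) (r : ℕ) :
    I.IsWitness F r (fullVec I True xB) ↔ rankWeight F (fullVec I True xB) ≤ r := by
  refine and_iff_right ?_
  rw [Instance.H, fullVec, Matrix.fromCols_mulVec]
  funext i
  simp [Function.comp_def]

variable [Fintype F]

variable (F) in
theorem frobSum_add (γ : Coord n k → L) (x x' : Coord n k → K) (e : ℕ) :
    frobSum (Fintype.card F) γ (x + x') e
      = frobSum (Fintype.card F) γ x e + frobSum (Fintype.card F) γ x' e := by
  simp only [frobSum, Pi.add_apply, ← frobeniusAlgHom_pow_apply F, map_add, map_sub,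
    ← Finset.sum_add_distrib]
  exact Finset.sum_congr rfl fun j _ => by ring

/-- Sum of two shares. -/
def Share.add (s s' : Share K L k r) : Share K L k r :=
  ⟨s.xB + s'.xB, s.β + s'.β, s.a + s'.a, s.c + s'.c⟩

/-- Exactly one main party of each dimension contains the last leaf, so `y` is added once. -/
theorem fullVec_add_not (I : Instance K n k) (b : Bool) (x x' : Fin k → K) :
    fullVec I (b = true) x + fullVec I ((!b) = true) x' = fullVec I True (x + x') := by
  funext j
  rcases j with j | j <;> cases b <;> simp [fullVec, Matrix.mulVec_add] <;> ring

variable (F) in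
theorem alphaShare_add (I : Instance K n k) (ch : Ch1 L n k) (b : Bool) (s s' : Share K L k r) :
    alphaShare (Fintype.card F) I ch (b = true) s
        + alphaShare (Fintype.card F) I ch ((!b) = true) s'
      = alphaShare (Fintype.card F) I ch True (s.add s') := by
  funext e
  simp only [alphaShare, Pi.add_apply, Share.add]
  rw [← fullVec_add_not I b, frobSum_add]
  ring

variable (F) in
theorem vShare_add (I : Instance K n k) (ch : Ch1 L n k) (b : Bool) (α : Fin (r - 1) → L)
    (s s' : Share K L k r) :
    vShare (Fintype.card F) I ch (b = true) α s + vShare (Fintype.card F) I ch ((!b) = true) α s'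
      = vShare (Fintype.card F) I ch True α (s.add s') := by
  simp only [vShare, Share.add]
  rw [← fullVec_add_not I b, frobSum_add]
  simp only [Pi.add_apply, map_add, mul_add, Finset.sum_add_distrib]
  ring

/-- The value `v` computed from the shared values. -/
def vValue (q : ℕ) (I : Instance K n k) (s : Share K L k r) (ch : Ch1 L n k) : L :=
  vShare q I ch True (alphaShare q I ch True s) s

variable (F) in
-- In `⟨α, β⟩` the part `ε ⟨ω, β⟩` merges with `ε z` into the `q`-polynomial, while `a` and `c`
-- contribute only a term independent of the challenge.
theorem vValue_eq (I : Instance K n k) (s : Share K L k r) (ch : Ch1 L n k) :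
    vValue (Fintype.card F) I s ch
      = -(ch.2 * ∑ j, ch.1 j * algebraMap K L (qPoly F r s.β (fullVec I True s.xB j)))
        - (∑ e, s.a e * algebraMap K L (s.β e)) - s.c := by
  simp only [vValue, vShare, alphaShare, frobSum, qPoly_apply, map_add, map_sum, map_mul, mul_add,
    add_mul, Finset.sum_add_distrib, Finset.mul_sum, Finset.sum_mul]
  rw [Finset.sum_comm]
  simp only [neg_add, mul_neg, Finset.mul_sum]
  have : ∀ (i : Fin (r - 1)) (j : Coord n k),
      ch.2 * (ch.1 j * algebraMap K L
        (fullVec I True s.xB j ^ Fintype.card F ^ (i.val + 1) - fullVec I True s.xB j))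
        * algebraMap K L (s.β i)
      = ch.2 * (ch.1 j * (algebraMap K L (s.β i) * algebraMap K L
        (fullVec I True s.xB j ^ Fintype.card F ^ (i.val + 1) - fullVec I True s.xB j))) := by
    intros; ring
  simp only [this]
  ring

open Classical in
-- If the `q`-polynomial vanished at all entries, they would lie in its kernel, of dimension at most
-- `r`, and the vector would be a witness. So the form in `γ` is nonzero.
theorem card_vValue_eq_zero_le [Finite K] [Fintype L] (hr : 1 ≤ r) (I : Instance K n k)
    (s : Share K L k r) (hs : ¬ I.IsWitness F r (fullVec I True s.xB)) :
    ((Finset.univ.filter fun ch : Ch1 L n k => vValue (Fintype.card F) I s ch = 0).card : ℝ)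
      ≤ (2 / Fintype.card L - 1 / (Fintype.card L : ℝ) ^ 2) * Fintype.card (Ch1 L n k) := by
  set y : Coord n k → L := fun j => algebraMap K L (qPoly F r s.β (fullVec I True s.xB j)) with hy
  have hy0 : y ≠ 0 := by
    intro h0
    refine hs ((fullVec_isWitness_iff I s.xB r).2 ?_)
    refine (rankWeight_le_finrank F _ (LinearMap.ker (qPoly F r s.β)) fun j => ?_).trans
      (finrank_ker_qPoly_le F hr s.β)
    have := congrFun h0 j
    simpa [hy] using this
  refine le_trans ?_ (card_false_positive_le y hy0
    (-(∑ e, s.a e * algebraMap K L (s.β e)) - s.c))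
  refine Nat.cast_le.2 (Finset.card_le_card (Finset.monotone_filter_right _ fun ch _ h => ?_))
  rw [vValue_eq] at h
  linear_combination -h

end Linear

/-! ### Sums of shares over the leaves of a main party -/

section MainParty

variable {K L : Type*} [Field K] [Field L] {n k r D : ℕ} {Seed Salt Rnd Cmt Dig : Type*}
  {S : Primitives K L k r D Seed Salt Rnd Cmt Dig}
  {T : Transcript K L n k r D Seed Salt Cmt Dig}

theorem sum_opened {M : Type*} [AddCommMonoid M] {i : Leaf D} {d : Fin D} {b : Bool}
    (hb : i d ≠ b) (g : Leaf D → M) :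
    ∑ j ∈ Finset.univ.filter (fun j : {j : Leaf D // j ≠ i} => j.1 d = b), g j.1
      = ∑ j ∈ Finset.univ.filter (fun j : Leaf D => j d = b), g j := by
  refine Finset.sum_bij (fun j _ => j.1) ?_ ?_ ?_ ?_
  · intro j hj; simpa using hj
  · intro j _ j' _ h; exact Subtype.ext h
  · intro j hj
    have hj' : j d = b := by simpa using hj
    exact ⟨⟨j, fun h => hb (h ▸ hj')⟩, by simpa using hj', rfl⟩
  · intro _ _; rfl

theorem Transcript.mainShare_eq {s : Leaf D → Share K L k r} (hs : ∀ j, T.share S j = s j.1)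
    {d : Fin D} {b : Bool} (hb : T.ch2 d ≠ b) :
    T.mainShare S d b = Share.sum (Finset.univ.filter fun j : Leaf D => j d = b) s := by
  simp only [Transcript.mainShare, Share.sum, hs]
  rw [sum_opened hb fun j => (s j).xB, sum_opened hb fun j => (s j).β,
    sum_opened hb fun j => (s j).a, sum_opened hb fun j => (s j).c]

theorem Share.add_sum_filter (s : Leaf D → Share K L k r) (d : Fin D) (b : Bool) :
    (Share.sum (Finset.univ.filter fun j : Leaf D => j d = b) s).add
        (Share.sum (Finset.univ.filter fun j : Leaf D => j d = !b) s)
      = Share.sum Finset.univ s := by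
  have h : (Finset.univ.filter fun j : Leaf D => j d = !b)
      = Finset.univ.filter fun j : Leaf D => ¬ j d = b := by
    ext j; simp [Bool.eq_not]
  simp only [Share.add, Share.sum, h, Finset.sum_filter_add_sum_filter_not]

theorem sum_bool_eq {M : Type*} [AddCommMonoid M] (f : Bool → M) (b : Bool) :
    ∑ b', f b' = f b + f (!b) := by
  cases b <;> simp [add_comm]

end MainParty

/-! ### Consistency of accepted transcripts -/

section Consistency

variable {F K L : Type*} [Field F] [Fintype F] [Field K] [Algebra F K] [Module.Finite F K]
  [Field L] [Algebra K L] {n k r D : ℕ} {Seed Salt Rnd Cmt Dig : Type*}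
  {S : Primitives K L k r D Seed Salt Rnd Cmt Dig} {I : Instance K n k}
  {T T' T₁ T₂ : Transcript K L n k r D Seed Salt Cmt Dig}

variable (F S I T T') in
/-- No valid output can be read off from the two transcripts. -/
def NoOutput : Prop :=
  ∀ o ∈ readOff S I (Fintype.card F) T T', ¬ o.Valid F S I

theorem NoOutput.cmts_eq (h : NoOutput F S I T T') (hT : T.Accepts S I (Fintype.card F))
    (hT' : T'.Accepts S I (Fintype.card F)) (h0 : T.h0 = T'.h0) : T.cmts S = T'.cmts S := by
  by_contra hne
  exact h (.hashCmts (T.cmts S) (T'.cmts S)) (by simp [readOff])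
    ⟨hne, by rw [hT.1, hT'.1, h0]⟩

theorem NoOutput.state_eq (h : NoOutput F S I T T') (hT : T.Accepts S I (Fintype.card F))
    (hT' : T'.Accepts S I (Fintype.card F)) (h0 : T.h0 = T'.h0) {j : Leaf D} (hj : j ≠ T.ch2)
    (hj' : j ≠ T'.ch2) : T.state S ⟨j, hj⟩ = T'.state S ⟨j, hj'⟩ := by
  by_contra hne
  refine h (.com (T.state S ⟨j, hj⟩) (T'.state S ⟨j, hj'⟩) (T.rnd S ⟨j, hj⟩) (T'.rnd S ⟨j, hj'⟩))
    ?_ ⟨hne, ?_⟩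
  · simp only [readOff, List.mem_append, List.mem_map, Finset.mem_toList]
    exact Or.inl (Or.inl (Or.inl (Or.inl ⟨⟨j, hj, hj'⟩, Finset.mem_univ _, rfl⟩)))
  · have := congrFun (h.cmts_eq hT hT' h0) j
    simpa only [Transcript.cmts, dif_pos hj, dif_pos hj'] using this

theorem NoOutput.share_eq (h : NoOutput F S I T T') (hT : T.Accepts S I (Fintype.card F))
    (hT' : T'.Accepts S I (Fintype.card F)) (h0 : T.h0 = T'.h0) {j : Leaf D} (hj : j ≠ T.ch2)
    (hj' : j ≠ T'.ch2) : T.share S ⟨j, hj⟩ = T'.share S ⟨j, hj'⟩ := by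
  rw [Transcript.share, Transcript.share, h.state_eq hT hT' h0 hj hj']

theorem NoOutput.exec_eq (h : NoOutput F S I T T') (hT : T.Accepts S I (Fintype.card F))
    (hT' : T'.Accepts S I (Fintype.card F)) (h1 : T.h1 = T'.h1) (d : Fin D) :
    T.exec S I (Fintype.card F) d = T'.exec S I (Fintype.card F) d := by
  have hall : T.execHashes S I (Fintype.card F) = T'.execHashes S I (Fintype.card F) := by
    by_contra hne
    exact h (.hashAll _ _) (by simp [readOff]) ⟨hne, by rw [hT.2.2.2, hT'.2.2.2, h1]⟩
  by_contra hne
  refine h (.hashExec (T.exec S I (Fintype.card F) d) (T'.exec S I (Fintype.card F) d)) ?_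
    ⟨hne, congrFun hall d⟩
  simp only [readOff, List.mem_append, List.mem_map, Finset.mem_toList]
  exact Or.inl (Or.inl (Or.inr ⟨d, Finset.mem_univ _, rfl⟩))

variable (S T₁ T₂) in
/-- The shares of all the leaves, read from two transcripts with distinct hidden leaves. -/
def jointShare (hne : T₁.ch2 ≠ T₂.ch2) (j : Leaf D) : Share K L k r :=
  if hj : j ≠ T₁.ch2 then T₁.share S ⟨j, hj⟩ else T₂.share S ⟨j, by rw [not_not.1 hj]; exact hne⟩

theorem NoOutput.not_isWitness (h : NoOutput F S I T₁ T₂) (hne : T₁.ch2 ≠ T₂.ch2) :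
    ¬ I.IsWitness F r (fullVec I True (Share.sum Finset.univ (jointShare S T₁ T₂ hne)).xB) := by
  have hsum : (Share.sum Finset.univ (jointShare S T₁ T₂ hne)).xB
      = (∑ j, (T₁.share S j).xB) + (T₂.share S ⟨T₁.ch2, hne⟩).xB := by
    have h1 : ∑ j : {j : Leaf D // j ≠ T₁.ch2}, (T₁.share S j).xB
        = ∑ j : {j : Leaf D // j ≠ T₁.ch2}, (jointShare S T₁ T₂ hne j.1).xB :=
      Finset.sum_congr rfl fun j _ => by rw [jointShare, dif_pos j.2]
    have h2 : (T₂.share S ⟨T₁.ch2, hne⟩).xB = (jointShare S T₁ T₂ hne T₁.ch2).xB := by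
      simp [jointShare]
    rw [h1, h2, add_comm]
    exact Fintype.sum_eq_add_sum_subtype_ne (fun j => (jointShare S T₁ T₂ hne j).xB) T₁.ch2
  rw [hsum]
  refine h (.witness _) ?_
  simp only [readOff, dif_pos hne, List.mem_append, List.mem_singleton]
  exact Or.inr trivial

/-- Two accepted transcripts with the same first challenge, distinct hidden leaves and shares that
belong to a common sharing yield the value `v = 0` for the shared values. -/
theorem NoOutput.vValue_eq_zero (h : NoOutput F S I T T') (hT : T.Accepts S I (Fintype.card F))
    (hT' : T'.Accepts S I (Fintype.card F)) (hch : T.ch1 = T'.ch1) (h1 : T.h1 = T'.h1)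
    (hne : T.ch2 ≠ T'.ch2) {s : Leaf D → Share K L k r} (hs : ∀ j, T.share S j = s j.1)
    (hs' : ∀ j, T'.share S j = s j.1) :
    vValue (Fintype.card F) I (Share.sum Finset.univ s) T.ch1 = 0 := by
  -- In dimension `d`, the main party hiding a leaf in `T` is fully opened in `T'`, and conversely.
  -- As the hashed data agree, both parties' values can be taken as honestly computed.
  obtain ⟨d, hd⟩ := Function.ne_iff.1 hne
  have hexec := h.exec_eq hT hT' h1 d
  have hα : T.mainAlpha S I (Fintype.card F) d = T'.mainAlpha S I (Fintype.card F) d :=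
    congrArg Prod.fst hexec
  have hv : T.mainV S I (Fintype.card F) d = T'.mainV S I (Fintype.card F) d :=
    congrArg Prod.snd hexec
  have hne1 : T.ch2 d ≠ !(T.ch2 d) := by simp
  have hne2 : T'.ch2 d ≠ T.ch2 d := hd.symm
  have halpha : T.alpha S I (Fintype.card F) d
      = alphaShare (Fintype.card F) I T.ch1 True (Share.sum Finset.univ s) := by
    rw [Transcript.alpha, sum_bool_eq _ (T.ch2 d), ← Share.add_sum_filter s d (T.ch2 d),
      ← alphaShare_add F I T.ch1 (T.ch2 d), congrFun hα (T.ch2 d)]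
    simp only [Transcript.mainAlpha, if_neg hne1, if_neg hne2]
    rw [Transcript.mainShare_eq hs hne1, Transcript.mainShare_eq hs' hne2, hch]
  have halpha' : T'.alpha S I (Fintype.card F) d = T.alpha S I (Fintype.card F) d := by
    rw [Transcript.alpha, Transcript.alpha, hα]
  have hsum := hT.2.1 d
  rw [sum_bool_eq _ (T.ch2 d), congrFun hv (T.ch2 d)] at hsum
  simp only [Transcript.mainV, if_neg hne1, if_neg hne2] at hsum
  rw [Transcript.mainShare_eq hs hne1, Transcript.mainShare_eq hs' hne2, ← hch, halpha',
    vShare_add F I T.ch1 (T.ch2 d), Share.add_sum_filter, halpha] at hsum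
  exact hsum

/-- Every leaf is opened in `T₁` or in `T₂`, and the common `h0` binds its state. -/
theorem NoOutput.share_eq_jointShare (hne : T₁.ch2 ≠ T₂.ch2) (h₁ : NoOutput F S I T₁ T)
    (h₂ : NoOutput F S I T₂ T) (hT₁ : T₁.Accepts S I (Fintype.card F))
    (hT₂ : T₂.Accepts S I (Fintype.card F)) (hT : T.Accepts S I (Fintype.card F))
    (h0₁ : T₁.h0 = T.h0) (h0₂ : T₂.h0 = T.h0) (j : {j : Leaf D // j ≠ T.ch2}) :
    T.share S j = jointShare S T₁ T₂ hne j.1 := by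
  unfold jointShare
  split_ifs with hj
  · exact (h₁.share_eq hT₁ hT h0₁ hj j.2).symm
  · exact (h₂.share_eq hT₂ hT h0₂ _ j.2).symm

end Consistency

/-! ### First challenges that two accepted transcripts leave open -/

section Trap

variable {F K L : Type*} [Field F] [Fintype F] [Field K] [Finite K] [Algebra F K]
  [Field L] [Fintype L] [Algebra K L] {n k r D : ℕ} {Seed Salt Rnd Cmt Dig Tape : Type*}

variable (F) in
/-- Whether the verifier accepts, for a given tape and given challenges. -/
def Prover.Acc (P : Prover K L n k r D Seed Salt Cmt Dig Tape)
    (S : Primitives K L k r D Seed Salt Rnd Cmt Dig) (I : Instance K n k) (t : Tape)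
    (c : Ch1 L n k) (i : Leaf D) : Prop :=
  (P.transcript t c i).Accepts S I (Fintype.card F)

variable (F) in
/-- As long as the extractor has no output, the calls of `h` allow the tape `t` to have two
accepted executions with the same first challenge only if this challenge is in `G`. -/
def Confines (S : Primitives K L k r D Seed Salt Rnd Cmt Dig) (I : Instance K n k)
    (P : Prover K L n k r D Seed Salt Cmt Dig Tape) (h : List (Query L n k D × Tape)) (t : Tape)
    (G : Finset (Ch1 L n k)) : Prop :=
  ∀ h', h ⊆ h' → Extractor.output F S I P h' = none → ∀ c i j, i ≠ j → P.Acc F S I t c i →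
    P.Acc F S I t c j → P.transcript t c i ∈ Extractor.transcripts P h' →
    P.transcript t c j ∈ Extractor.transcripts P h' → c ∈ G

theorem Confines.mono {S : Primitives K L k r D Seed Salt Rnd Cmt Dig} {I : Instance K n k}
    {P : Prover K L n k r D Seed Salt Cmt Dig Tape} {h h' : List (Query L n k D × Tape)} {t : Tape}
    {G : Finset (Ch1 L n k)} (hG : Confines F S I P h t G) (hh : h ⊆ h') :
    Confines F S I P h' t G :=
  fun _ hh' => hG _ (List.Subset.trans hh hh')

/-- The set `G` consists of the zeros of `v` for the joint shares. It depends only on the two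
transcripts at hand, hence is fixed before later challenges are drawn. -/
theorem exists_confines (hr : 1 ≤ r) {S : Primitives K L k r D Seed Salt Rnd Cmt Dig}
    {I : Instance K n k} {P : Prover K L n k r D Seed Salt Cmt Dig Tape}
    {h : List (Query L n k D × Tape)} (ho : Extractor.output F S I P h = none) {t : Tape}
    {c₁ c₂ : Ch1 L n k} {i₁ i₂ : Leaf D} (hi : i₁ ≠ i₂) (hacc₁ : P.Acc F S I t c₁ i₁)
    (hacc₂ : P.Acc F S I t c₂ i₂) (hm₁ : P.transcript t c₁ i₁ ∈ Extractor.transcripts P h)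
    (hm₂ : P.transcript t c₂ i₂ ∈ Extractor.transcripts P h) :
    ∃ G : Finset (Ch1 L n k), ((G.card : ℝ)
      ≤ (2 / Fintype.card L - 1 / (Fintype.card L : ℝ) ^ 2) * Fintype.card (Ch1 L n k)) ∧
      Confines F S I P h t G := by
  classical
  have hno : ∀ {h' T T'}, Extractor.output F S I P h' = none → T ∈ Extractor.transcripts P h' →
      T' ∈ Extractor.transcripts P h' → NoOutput F S I T T' :=
    fun ho' hT hT' _ hm => Extractor.not_valid_of_output_eq_none F S I P ho' hT hT' hm
  have hne : (P.transcript t c₁ i₁).ch2 ≠ (P.transcript t c₂ i₂).ch2 := hi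
  refine ⟨_, card_vValue_eq_zero_le hr I _ ((hno ho hm₁ hm₂).not_isWitness hne), ?_⟩
  intro h' hh ho' c i j hij hai haj hmi hmj
  have hsub : ∀ {T}, T ∈ Extractor.transcripts P h → T ∈ Extractor.transcripts P h' :=
    fun hT => List.map_subset _ hh hT
  rw [Finset.mem_filter]
  refine ⟨Finset.mem_univ _, ?_⟩
  exact (hno ho' hmi hmj).vValue_eq_zero hai haj rfl rfl hij
    (NoOutput.share_eq_jointShare hne (hno ho' (hsub hm₁) hmi) (hno ho' (hsub hm₂) hmi)
      hacc₁ hacc₂ hai rfl rfl)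
    (NoOutput.share_eq_jointShare hne (hno ho' (hsub hm₁) hmj) (hno ho' (hsub hm₂) hmj)
      hacc₁ hacc₂ haj rfl rfl)

end Trap

end RankSD

/-- A new session draws its tape after the query; exchanging the two allows the analysis to fix the
tape first. -/
theorem PMF.lexp_comm {α β : Type*} (p : PMF α) (p' : PMF β) (g : α → β → ℝ≥0∞) :
    (p.lexp fun a => p'.lexp fun b => g a b) = p'.lexp fun b => p.lexp fun a => g a b := by
  simp only [lexp, ← ENNReal.tsum_mul_left]
  rw [ENNReal.tsum_comm]
  exact tsum_congr fun b => tsum_congr fun a => by ring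

namespace RankSD

/-! ### The extractor -/

/-- Situation of the extractor: it starts a new session, or it has found a pair of accepted
executions with the same first challenge in the session `s`, or it repeats the first challenge `c`,
accepted with the hidden leaf `i`, at most `f + 1` times. In the last case, `second` tells whether
a pair has already been found in the session. -/
inductive Mode (L : Type*) (n k D : ℕ)
  | start
  | pair (s : ℕ)
  | rep (second : Bool) (s : ℕ) (c : Ch1 L n k) (i : Leaf D) (f : ℕ)

namespace Mode

variable {L : Type*} {n k D : ℕ}

/-- Repeat a first challenge at most `f` times. -/
def retry (second : Bool) (s : ℕ) (c : Ch1 L n k) (i : Leaf D) : ℕ → Mode L n k D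
  | 0 => if second then .pair s else .start
  | f + 1 => .rep second s c i f

/-- Situation after a call. -/
def update (B : ℕ) : Mode L n k D → Query L n k D × Bool → Mode L n k D
  | .start, x => if x.2 then retry false x.1.session x.1.ch1 x.1.ch2 B else .start
  | .pair s, x => if x.2 then retry true s x.1.ch1 x.1.ch2 B else .pair s
  | .rep second s c i f, x =>
    if x.2 = true ∧ x.1.ch2 ≠ i then (if second then .start else .pair s)
    else retry second s c i f

/-- Situation after a list of calls. -/
def ofHistory (B : ℕ) (h : List (Query L n k D × Bool)) : Mode L n k D :=
  h.foldr (fun x m => m.update B x) .start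

end Mode

/-- In a new session, the extractor tries uniform challenges, and if they are accepted it repeats
the first one with uniform hidden leaves, at most `B` times, until it finds a pair of accepted
executions with distinct hidden leaves. Having failed, it starts a new session; having found a pair,
it proceeds in the same way within the session until it finds a second pair. -/
def pairExtractor (L : Type*) [Field L] [Fintype L] (n k D B : ℕ) : Extractor L n k D where
  next h :=
    match Mode.ofHistory B h with
    | .start => (PMF.uniformOfFintype (Ch1 L n k × Leaf D)).map fun x =>
        ⟨(h.map fun c => c.1.session).sum + 1, x.1, x.2⟩
    | .pair s => (PMF.uniformOfFintype (Ch1 L n k × Leaf D)).map fun x => ⟨s, x.1, x.2⟩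
    | .rep _ s c _ _ => (PMF.uniformOfFintype (Leaf D)).map fun j => ⟨s, c, j⟩

section Analysis

variable (F : Type*) {K L : Type*} [Field F] [Fintype F] [Field K] [Finite K] [Algebra F K]
  [Field L] [Fintype L] [Algebra K L] {n k r D : ℕ} {Seed Salt Rnd Cmt Dig Tape : Type*}
  (S : Primitives K L k r D Seed Salt Rnd Cmt Dig) (I : Instance K n k)
  (P : Prover K L n k r D Seed Salt Cmt Dig Tape) (B : ℕ) (p Δ V : ℝ)

open Classical in
/-- What the extractor sees of a list of calls. -/
def view (h : List (Query L n k D × Tape)) : List (Query L n k D × Bool) :=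
  h.map fun c => (c.1, decide ((P.transcript c.2 c.1.ch1 c.1.ch2).Accepts S I (Fintype.card F)))

/-- The situation after the calls `h` has potential at most `v`. -/
inductive Bound (h : List (Query L n k D × Tape)) : ℝ → Prop
  | halted (ho : (Extractor.output F S I P h).isSome) : Bound h 0
  | start (hm : Mode.ofHistory B (view F S I P h) = .start) : Bound h V
  | pair (q : Query L n k D) (t : Tape) (G : Finset (Ch1 L n k))
      (hm : Mode.ofHistory B (view F S I P h) = .pair q.session) (hq : h.head? = some (q, t))
      (hπ : 0 < pairProb (P.Acc F S I t) B) (hG : (G.card : ℝ) ≤ p * Fintype.card (Ch1 L n k))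
      (hc : Confines F S I P h t G) : Bound h (pairPotential (P.Acc F S I t) B p Δ V)
  | firstRep (q : Query L n k D) (t : Tape) (c : Ch1 L n k) (i : Leaf D) (f : ℕ)
      (hm : Mode.ofHistory B (view F S I P h) = .rep false q.session c i f)
      (hq : h.head? = some (q, t)) (hacc : P.Acc F S I t c i)
      (hmem : P.transcript t c i ∈ Extractor.transcripts P h) :
      Bound h (trialCost (otherRate (P.Acc F S I t) c) (pairPotential (P.Acc F S I t) B p Δ V) V
        (f + 1))
  | secondRep (q : Query L n k D) (t : Tape) (G : Finset (Ch1 L n k)) (c : Ch1 L n k) (i : Leaf D)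
      (f : ℕ) (hm : Mode.ofHistory B (view F S I P h) = .rep true q.session c i f)
      (hq : h.head? = some (q, t)) (hacc : P.Acc F S I t c i)
      (hmem : P.transcript t c i ∈ Extractor.transcripts P h)
      (hπ : 0 < pairProb (P.Acc F S I t) B) (hG : (G.card : ℝ) ≤ p * Fintype.card (Ch1 L n k))
      (hc : Confines F S I P h t G) :
      Bound h (trialCost (otherRate (P.Acc F S I t) c)
        ((G : Set (Ch1 L n k)).indicator (fun _ => V) c) (pairPotential (P.Acc F S I t) B p Δ V)
        (f + 1))

/-- The potential: a bound for the expected number of further calls. -/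
def potential (h : List (Query L n k D × Tape)) : ℝ≥0∞ :=
  ⨅ v : ℝ, ⨅ _ : Bound F S I P B p Δ V h v, ENNReal.ofReal v

variable {F S I P B p Δ V} {h : List (Query L n k D × Tape)}

theorem potential_le {v : ℝ} (hv : Bound F S I P B p Δ V h v) :
    potential F S I P B p Δ V h ≤ ENNReal.ofReal v :=
  iInf₂_le v hv

/-- With no repetition left, `retry` is the failure situation, in accordance with `trialCost` at
`0`. -/
theorem Bound.of_retry_false {q : Query L n k D} {t : Tape} {c : Ch1 L n k} {i : Leaf D} {f : ℕ}
    (hm : Mode.ofHistory B (view F S I P h) = .retry false q.session c i f)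
    (hq : h.head? = some (q, t)) (hacc : P.Acc F S I t c i)
    (hmem : P.transcript t c i ∈ Extractor.transcripts P h) :
    Bound F S I P B p Δ V h (trialCost (otherRate (P.Acc F S I t) c)
      (pairPotential (P.Acc F S I t) B p Δ V) V f) := by
  cases f with
  | zero => exact .start hm
  | succ f => exact .firstRep q t c i f hm hq hacc hmem

theorem Bound.of_retry_true {q : Query L n k D} {t : Tape} {c : Ch1 L n k} {i : Leaf D} {f : ℕ}
    {G : Finset (Ch1 L n k)}
    (hm : Mode.ofHistory B (view F S I P h) = .retry true q.session c i f)
    (hq : h.head? = some (q, t)) (hacc : P.Acc F S I t c i)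
    (hmem : P.transcript t c i ∈ Extractor.transcripts P h)
    (hπ : 0 < pairProb (P.Acc F S I t) B) (hG : (G.card : ℝ) ≤ p * Fintype.card (Ch1 L n k))
    (hc : Confines F S I P h t G) :
    Bound F S I P B p Δ V h (trialCost (otherRate (P.Acc F S I t) c)
      ((G : Set (Ch1 L n k)).indicator (fun _ => V) c) (pairPotential (P.Acc F S I t) B p Δ V) f) := by
  cases f with
  | zero => exact .pair q t G hm hq hπ hG hc
  | succ f => exact .secondRep q t G c i f hm hq hacc hmem hπ hG hc

open Classical in
theorem ofHistory_view_cons (q : Query L n k D) (t : Tape) :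
    Mode.ofHistory B (view F S I P ((q, t) :: h))
      = (Mode.ofHistory B (view F S I P h)).update B (q, decide (P.Acc F S I t q.ch1 q.ch2)) :=
  rfl

theorem mem_transcripts_cons (q : Query L n k D) (t : Tape) :
    P.transcript t q.ch1 q.ch2 ∈ Extractor.transcripts P ((q, t) :: h) :=
  List.mem_cons_self

theorem mem_transcripts_of_mem {T : Transcript K L n k r D Seed Salt Cmt Dig}
    (x : Query L n k D × Tape) (hT : T ∈ Extractor.transcripts P h) :
    T ∈ Extractor.transcripts P (x :: h) :=
  List.mem_cons_of_mem _ hT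

open Classical in
-- The latest call belongs to the session, so the search for an earlier call stops at the head and
-- returns its tape `t`.
theorem lexp_step_old_session (E : Extractor L n k D) (ho : Extractor.output F S I P h = none)
    {q : Query L n k D} {t : Tape} (hq : h.head? = some (q, t)) {α : Type*} (μ : PMF α)
    (g : α → Query L n k D) (hg : ∀ a, (g a).session = q.session)
    (hnext : E.next (view F S I P h) = μ.map g) (Φ : List (Query L n k D × Tape) → ℝ≥0∞) :
    (E.step F S I P h).lexp Φ = μ.lexp fun a => Φ ((g a, t) :: h) := by
  have hfind : ∀ a, h.find? (fun c : Query L n k D × Tape => decide (c.1.session = (g a).session))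
      = some (q, t) := by
    intro a
    obtain ⟨l, rfl⟩ : ∃ l, h = (q, t) :: l := ⟨h.tail, (List.cons_head?_tail hq).symm⟩
    rw [List.find?_cons_of_pos]
    simp [hg]
  unfold Extractor.step
  rw [ho]
  change ((if _ then _ else (E.next (view F S I P h)).bind _ : PMF _)).lexp Φ = _
  rw [hnext, if_neg (by simp), PMF.lexp_bind, PMF.lexp_map]
  simp only [hfind, PMF.lexp_map, PMF.lexp_pure]

open Classical in
-- The new label exceeds the sum of all earlier ones, hence each of them, so a fresh tape is drawn.
theorem lexp_step_new_session (E : Extractor L n k D) (ho : Extractor.output F S I P h = none)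
    {α : Type*} (μ : PMF α) (g : α → Query L n k D)
    (hg : ∀ a, (g a).session = ((view F S I P h).map fun c => c.1.session).sum + 1)
    (hnext : E.next (view F S I P h) = μ.map g) (Φ : List (Query L n k D × Tape) → ℝ≥0∞) :
    (E.step F S I P h).lexp Φ = μ.lexp fun a => P.tape.lexp fun t => Φ ((g a, t) :: h) := by
  have hfind : ∀ a, h.find? (fun c : Query L n k D × Tape => decide (c.1.session = (g a).session))
      = none := by
    intro a
    rw [List.find?_eq_none]
    intro c hc
    have : c.1.session ≤ ((view F S I P h).map fun c => c.1.session).sum := by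
      refine List.le_sum_of_mem ?_
      simp only [view, List.map_map, List.mem_map]
      exact ⟨c, hc, rfl⟩
    simp only [decide_eq_true_eq, hg]
    omega
  unfold Extractor.step
  rw [ho]
  change ((if _ then _ else (E.next (view F S I P h)).bind _ : PMF _)).lexp Φ = _
  rw [hnext, if_neg (by simp), PMF.lexp_bind, PMF.lexp_map]
  simp only [hfind, PMF.lexp_map]

open Classical in
theorem lexp_uniform_ite {C J : Type*} [Fintype C] [Fintype J] [Nonempty C] [Nonempty J]
    {acc : C → J → Prop} {x : C → ℝ} {y : ℝ} (hx : ∀ c, 0 ≤ x c) (hy : 0 ≤ y) :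
    (PMF.uniformOfFintype (C × J)).lexp
        (fun z => ENNReal.ofReal (if acc z.1 z.2 then x z.1 else y))
      = ENNReal.ofReal (avg fun c => rate acc c * x c + (1 - rate acc c) * y) := by
  rw [PMF.lexp_uniform_ofReal _ fun z => by split_ifs; exacts [hx _, hy]]
  simp_rw [avg, ← sum_acc_div, Fintype.sum_prod_type, ← Finset.sum_div, Fintype.card_prod]
  push_cast
  rw [div_div, mul_comm]

theorem one_add_ofReal_le {x y : ℝ} (hx : 0 ≤ x) (h : 1 + x ≤ y) :
    1 + ENNReal.ofReal x ≤ ENNReal.ofReal y := by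
  rw [← ENNReal.ofReal_one, ← ENNReal.ofReal_add zero_le_one hx]
  exact ENNReal.ofReal_le_ofReal h

theorem avg_trialCost_nonneg {C J : Type*} [Fintype C] [Fintype J] {acc : C → J → Prop}
    {out : C → ℝ} {fail : ℝ} (ho : ∀ c, 0 ≤ out c) (hf : 0 ≤ fail) :
    0 ≤ avg fun c => rate acc c * trialCost (otherRate acc c) (out c) fail B
      + (1 - rate acc c) * fail :=
  avg_nonneg fun c => add_nonneg (mul_nonneg (rate_nonneg c)
    (trialCost_nonneg (otherRate_nonneg c) (otherRate_le_one c) (ho c) hf B))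
    (mul_nonneg (sub_nonneg.2 (rate_le_one c)) hf)

end Analysis

/-! ### The potential decreases -/

section Steps

variable {F K L : Type*} [Field F] [Fintype F] [Field K] [Finite K] [Algebra F K]
  [Field L] [Fintype L] [Algebra K L] {n k r D : ℕ} {Seed Salt Rnd Cmt Dig Tape : Type*}
  {S : Primitives K L k r D Seed Salt Rnd Cmt Dig} {I : Instance K n k}
  {P : Prover K L n k r D Seed Salt Cmt Dig Tape} {B : ℕ} {p Δ V : ℝ}
  {h : List (Query L n k D × Tape)}

theorem step_pair (hΔ : 0 ≤ Δ) (hp : 0 ≤ p) (hV : 0 ≤ V)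
    (ho : Extractor.output F S I P h = none) {q : Query L n k D} {t : Tape}
    {G : Finset (Ch1 L n k)} (hm : Mode.ofHistory B (view F S I P h) = .pair q.session)
    (hq : h.head? = some (q, t)) (hπ : 0 < pairProb (P.Acc F S I t) B)
    (hG : (G.card : ℝ) ≤ p * Fintype.card (Ch1 L n k)) (hc : Confines F S I P h t G) :
    1 + ((pairExtractor L n k D B).step F S I P h).lexp (potential F S I P B p Δ V)
      ≤ ENNReal.ofReal (pairPotential (P.Acc F S I t) B p Δ V) := by
  classical
  set U := pairPotential (P.Acc F S I t) B p Δ V with hU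
  have hU0 : 0 ≤ U := pairPotential_nonneg hΔ hp hV B
  have hout : ∀ c, 0 ≤ (G : Set (Ch1 L n k)).indicator (fun _ => V) c :=
    fun c => Set.indicator_nonneg (fun _ _ => hV) c
  rw [lexp_step_old_session _ ho hq (PMF.uniformOfFintype (Ch1 L n k × Leaf D))
    (fun x => ⟨q.session, x.1, x.2⟩) (fun _ => rfl) (by simp only [pairExtractor, hm])]
  have hle : ∀ x : Ch1 L n k × Leaf D,
      potential F S I P B p Δ V ((⟨q.session, x.1, x.2⟩, t) :: h)
        ≤ ENNReal.ofReal (if P.Acc F S I t x.1 x.2 then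
          trialCost (otherRate (P.Acc F S I t) x.1)
            ((G : Set (Ch1 L n k)).indicator (fun _ => V) x.1) U B else U) := by
    rintro ⟨c, i⟩
    refine potential_le ?_
    have hmode := ofHistory_view_cons (F := F) (S := S) (I := I) (P := P) (B := B) (h := h)
      ⟨q.session, c, i⟩ t
    rw [hm] at hmode
    by_cases hacc : P.Acc F S I t c i
    all_goals simp only [hacc, Mode.update, decide_true, decide_false, if_true, Bool.false_eq_true,
      if_false] at hmode ⊢
    · exact .of_retry_true (q := ⟨q.session, c, i⟩) hmode rfl hacc (mem_transcripts_cons _ _) hπ hG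
        (hc.mono (List.subset_cons_self _ _))
    · exact .pair ⟨q.session, c, i⟩ t G hmode rfl hπ hG (hc.mono (List.subset_cons_self _ _))
  refine (add_le_add_right (PMF.lexp_mono _ hle) 1).trans ?_
  rw [lexp_uniform_ite (fun c => trialCost_nonneg (otherRate_nonneg c) (otherRate_le_one c)
    (hout c) hU0 B) hU0]
  exact one_add_ofReal_le (avg_trialCost_nonneg hout hU0) (pairPotential_step hΔ hV hG hπ)

open Classical in
-- Common to both searches. As `i` is accepted, the probability of hitting another accepted leaf is
-- exactly `otherRate`.
theorem step_rep (ho : Extractor.output F S I P h = none) {q : Query L n k D} {t : Tape}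
    {c : Ch1 L n k} {i : Leaf D} {f : ℕ} {second : Bool} {out fail : ℝ} (hout : 0 ≤ out)
    (hfail : 0 ≤ fail)
    (hm : Mode.ofHistory B (view F S I P h) = .rep second q.session c i f)
    (hq : h.head? = some (q, t)) (hacc : P.Acc F S I t c i)
    (hsucc : ∀ j, j ≠ i → P.Acc F S I t c j →
      potential F S I P B p Δ V ((⟨q.session, c, j⟩, t) :: h) ≤ ENNReal.ofReal out)
    (hretry : ∀ j, Mode.ofHistory B (view F S I P ((⟨q.session, c, j⟩, t) :: h))
        = .retry second q.session c i f →
      potential F S I P B p Δ V ((⟨q.session, c, j⟩, t) :: h)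
        ≤ ENNReal.ofReal (trialCost (otherRate (P.Acc F S I t) c) out fail f)) :
    1 + ((pairExtractor L n k D B).step F S I P h).lexp (potential F S I P B p Δ V)
      ≤ ENNReal.ofReal (trialCost (otherRate (P.Acc F S I t) c) out fail (f + 1)) := by
  set R := trialCost (otherRate (P.Acc F S I t) c) out fail f
  have hR : 0 ≤ R := trialCost_nonneg (otherRate_nonneg c) (otherRate_le_one c) hout hfail f
  rw [lexp_step_old_session _ ho hq (PMF.uniformOfFintype (Leaf D))
    (fun j => ⟨q.session, c, j⟩) (fun _ => rfl) (by simp only [pairExtractor, hm])]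
  have hle : ∀ j : Leaf D,
      potential F S I P B p Δ V ((⟨q.session, c, j⟩, t) :: h)
        ≤ ENNReal.ofReal (if P.Acc F S I t c j ∧ j ≠ i then out else R) := by
    intro j
    split_ifs with hj
    · exact hsucc j hj.2 hj.1
    · refine hretry j ?_
      rw [ofHistory_view_cons, hm]
      simp only [Mode.update, decide_eq_true_eq]
      exact if_neg hj
  refine (add_le_add_right (PMF.lexp_mono _ hle) 1).trans ?_
  rw [PMF.lexp_uniform_ofReal _ fun j => by split_ifs; exacts [hout, hR], sum_acc_ne_div hacc]
  refine one_add_ofReal_le (add_nonneg (mul_nonneg (otherRate_nonneg c) hout)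
    (mul_nonneg (sub_nonneg.2 (otherRate_le_one c)) hR)) (le_of_eq ?_)
  rw [trialCost]
  ring

theorem step_firstRep (hr : 1 ≤ r) (hB : B ≠ 0) (hΔ : 0 ≤ Δ) (hp : 0 ≤ p) (hV : 0 ≤ V)
    (hpL : p = 2 / Fintype.card L - 1 / (Fintype.card L : ℝ) ^ 2)
    (ho : Extractor.output F S I P h = none) {q : Query L n k D} {t : Tape}
    {c : Ch1 L n k} {i : Leaf D} {f : ℕ}
    (hm : Mode.ofHistory B (view F S I P h) = .rep false q.session c i f)
    (hq : h.head? = some (q, t)) (hacc : P.Acc F S I t c i)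
    (hmem : P.transcript t c i ∈ Extractor.transcripts P h) :
    1 + ((pairExtractor L n k D B).step F S I P h).lexp (potential F S I P B p Δ V)
      ≤ ENNReal.ofReal (trialCost (otherRate (P.Acc F S I t) c)
        (pairPotential (P.Acc F S I t) B p Δ V) V (f + 1)) := by
  refine step_rep ho (pairPotential_nonneg hΔ hp hV B) hV hm hq hacc (fun j hj haccj => ?_)
    fun j hmode => ?_
  -- Either the new pair already gives an output, with potential `0`, or it determines `G`. The pair
  -- also shows `π > 0`, so the second search ends almost surely.
  · rcases ho' : Extractor.output F S I P ((⟨q.session, c, j⟩, t) :: h) with _ | o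
    · obtain ⟨G, hG, hc⟩ := exists_confines hr ho' hj.symm hacc haccj
        (mem_transcripts_of_mem _ hmem) (mem_transcripts_cons ⟨q.session, c, j⟩ t)
      refine potential_le (.pair ⟨q.session, c, j⟩ t G ?_ rfl (pairProb_pos hB hacc haccj hj.symm)
        (hpL ▸ hG) hc)
      rw [ofHistory_view_cons, hm]
      simp [Mode.update, haccj, hj]
    · refine (potential_le (.halted (by simp [ho']))).trans ?_
      simp
  · exact potential_le (.of_retry_false (q := ⟨q.session, c, j⟩) hmode rfl hacc
      (mem_transcripts_of_mem _ hmem))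

theorem step_secondRep (hΔ : 0 ≤ Δ) (hp : 0 ≤ p) (hV : 0 ≤ V)
    (ho : Extractor.output F S I P h = none) {q : Query L n k D} {t : Tape}
    {G : Finset (Ch1 L n k)} {c : Ch1 L n k} {i : Leaf D} {f : ℕ}
    (hm : Mode.ofHistory B (view F S I P h) = .rep true q.session c i f)
    (hq : h.head? = some (q, t)) (hacc : P.Acc F S I t c i)
    (hmem : P.transcript t c i ∈ Extractor.transcripts P h)
    (hπ : 0 < pairProb (P.Acc F S I t) B) (hG : (G.card : ℝ) ≤ p * Fintype.card (Ch1 L n k))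
    (hc : Confines F S I P h t G) :
    1 + ((pairExtractor L n k D B).step F S I P h).lexp (potential F S I P B p Δ V)
      ≤ ENNReal.ofReal (trialCost (otherRate (P.Acc F S I t) c)
        ((G : Set (Ch1 L n k)).indicator (fun _ => V) c) (pairPotential (P.Acc F S I t) B p Δ V) (f + 1)) := by
  refine step_rep ho (Set.indicator_nonneg (fun _ _ => hV) c) (pairPotential_nonneg hΔ hp hV B) hm hq hacc
    (fun j hj haccj => ?_) fun j hmode => ?_
  · rcases ho' : Extractor.output F S I P ((⟨q.session, c, j⟩, t) :: h) with _ | o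
    -- A second pair without output must have its first challenge in `G`, and only then is the cost
    -- `V` of a restart charged.
    · rw [Set.indicator_of_mem (Finset.mem_coe.2 <| hc _ (List.subset_cons_self _ _) ho' c i j hj.symm hacc haccj
        (mem_transcripts_of_mem _ hmem) (mem_transcripts_cons ⟨q.session, c, j⟩ t))]
      refine potential_le (.start ?_)
      rw [ofHistory_view_cons, hm]
      simp [Mode.update, haccj, hj]
    · refine (potential_le (.halted (by simp [ho']))).trans ?_
      simp
  · exact potential_le (.of_retry_true (q := ⟨q.session, c, j⟩) hmode rfl hacc
      (mem_transcripts_of_mem _ hmem) hπ hG (hc.mono (List.subset_cons_self _ _)))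

theorem lexp_meanRate :
    P.tape.lexp (fun t => ENNReal.ofReal (meanRate (P.Acc F S I t)))
      = ENNReal.ofReal (P.acceptProb S I (Fintype.card F)) := by
  classical
  rw [Prover.acceptProb, ENNReal.ofReal_toReal, PMF.toOuterMeasure_eq_lexp, PMF.lexp_bind]
  · congr 1; funext t
    rw [PMF.lexp_bind]
    have : ∀ c, ((PMF.uniformOfFintype (Leaf D)).map fun i => P.transcript t c i).lexp
        (fun T => if T ∈ {T | T.Accepts S I (Fintype.card F)} then 1 else 0)
        = ENNReal.ofReal (rate (P.Acc F S I t) c) := by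
      intro c
      have h1 := sum_acc_div (acc := P.Acc F S I t) c 1 0
      rw [mul_one, mul_zero, add_zero] at h1
      rw [PMF.lexp_map, ← h1, ← PMF.lexp_uniform_ofReal _ fun i => by split_ifs <;> simp]
      congr 1; funext i
      by_cases hi : P.Acc F S I t c i
      · have hi' : P.transcript t c i ∈ {T | T.Accepts S I (Fintype.card F)} := hi
        rw [if_pos hi, if_pos hi', ENNReal.ofReal_one]
      · have hi' : P.transcript t c i ∉ {T | T.Accepts S I (Fintype.card F)} := hi
        rw [if_neg hi, if_neg hi', ENNReal.ofReal_zero]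
    simp_rw [this]
    rw [PMF.lexp_uniform_ofReal _ rate_nonneg]
    rfl
  · rw [PMF.toOuterMeasure_eq_lexp]
    refine ne_top_of_le_ne_top ENNReal.one_ne_top ?_
    refine (PMF.lexp_mono _ fun x => ?_).trans_eq (PMF.lexp_const _ 1)
    split_ifs <;> simp

theorem acceptProb_le_one : P.acceptProb S I (Fintype.card F) ≤ 1 := by
  have h1 : ENNReal.ofReal (P.acceptProb S I (Fintype.card F)) ≤ 1 := by
    rw [← lexp_meanRate]
    refine (PMF.lexp_mono _ fun t => ?_).trans_eq (PMF.lexp_const _ 1)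
    exact ENNReal.ofReal_le_one.2 meanRate_le_one
  exact ENNReal.ofReal_le_one.1 h1

theorem step_start (hΔ : 0 < Δ) (hp : 0 ≤ p) (hV : 0 ≤ V) {εt : ℝ}
    (hεt : P.acceptProb S I (Fintype.card F) = εt)
    (hεΔ : εt = p + (1 - p) * (1 / Fintype.card (Leaf D)) + Δ)
    (hVeq : V * (B * Δ * Δ / (1 + B * Δ)) = 2 * (1 + εt * B))
    (ho : Extractor.output F S I P h = none)
    (hm : Mode.ofHistory B (view F S I P h) = .start) :
    1 + ((pairExtractor L n k D B).step F S I P h).lexp (potential F S I P B p Δ V)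
      ≤ ENNReal.ofReal V := by
  classical
  set N := ((view F S I P h).map fun c => c.1.session).sum + 1
  set U := fun t => pairPotential (P.Acc F S I t) B p Δ V with hU
  have hU0 : ∀ t, 0 ≤ U t := fun t => pairPotential_nonneg hΔ.le hp hV B
  rw [lexp_step_new_session _ ho (PMF.uniformOfFintype (Ch1 L n k × Leaf D))
    (fun x => ⟨N, x.1, x.2⟩) (fun _ => rfl) (by simp only [pairExtractor, hm]; rfl), PMF.lexp_comm]
  have hle : ∀ t, ∀ x : Ch1 L n k × Leaf D,
      potential F S I P B p Δ V ((⟨N, x.1, x.2⟩, t) :: h)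
        ≤ ENNReal.ofReal (if P.Acc F S I t x.1 x.2 then
          trialCost (otherRate (P.Acc F S I t) x.1) (U t) V B else V) := by
    rintro t ⟨c, i⟩
    refine potential_le ?_
    have hmode := ofHistory_view_cons (F := F) (S := S) (I := I) (P := P) (B := B) (h := h)
      ⟨N, c, i⟩ t
    rw [hm] at hmode
    by_cases hacc : P.Acc F S I t c i
    all_goals simp only [hacc, Mode.update, decide_true, decide_false, if_true, Bool.false_eq_true,
      if_false] at hmode ⊢
    · exact .of_retry_false (q := ⟨N, c, i⟩) hmode rfl hacc (mem_transcripts_cons _ _)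
    · exact .start hmode
  refine (add_le_add_right (PMF.lexp_mono _ fun t => PMF.lexp_mono _ (hle t)) 1).trans ?_
  have havg := fun t => lexp_uniform_ite (acc := P.Acc F S I t)
    (x := fun c => trialCost (otherRate (P.Acc F S I t) c) (U t) V B)
    (fun c => trialCost_nonneg (otherRate_nonneg c) (otherRate_le_one c) (hU0 t) hV B) hV
  simp only [havg]
  nth_rw 1 [← PMF.lexp_const P.tape 1]
  rw [← PMF.lexp_add]
  set σ := tangentSlope (B * Δ) with hσ
  set τ := tangentOffset (B * Δ) Δ with hτ
  set ε := p + (1 - p) * (1 / (Fintype.card (Leaf D) : ℝ))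
  have hσ0 : 0 ≤ σ := by rw [hσ, tangentSlope]; positivity
  have hτ0 : 0 ≤ τ := by rw [hτ, tangentOffset]; positivity
  have hε0 : 0 ≤ ε := by
    have : (1 : ℝ) / Fintype.card (Leaf D) ≤ 1 :=
      div_le_one_of_le₀ (by exact_mod_cast Fintype.card_pos) (by positivity)
    have h2 : (0 : ℝ) ≤ 1 / Fintype.card (Leaf D) := by positivity
    change 0 ≤ p + (1 - p) * _
    nlinarith [mul_nonneg hp (sub_nonneg.2 this)]
  have hεt0 : 0 ≤ εt := by rw [hεΔ]; positivity
  have hmean := lexp_meanRate (F := F) (S := S) (I := I) (P := P)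
  rw [hεt] at hmean
  have hVσ : V * (σ * Δ - τ) = 2 * (1 + εt * B) := by
    rw [← hVeq, hσ, hτ, tangent_at (by positivity)]
  -- The gain `V σ (mean rate - ε)` of a tape may be negative. Adding `V σ εt` to both sides leaves
  -- only nonnegative terms, so that expectations in `[0, ∞]` apply.
  refine ENNReal.le_of_add_le_add_right (a := ENNReal.ofReal (V * σ * εt)) ENNReal.ofReal_ne_top ?_
  rw [ENNReal.ofReal_mul (by positivity), ← hmean, ← PMF.lexp_const_mul, ← PMF.lexp_add]
  have hpt : ∀ t, 1 + ENNReal.ofReal (avg fun c => rate (P.Acc F S I t) c *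
        trialCost (otherRate (P.Acc F S I t) c) (U t) V B + (1 - rate (P.Acc F S I t) c) * V)
        + ENNReal.ofReal (V * σ) * ENNReal.ofReal (meanRate (P.Acc F S I t))
      ≤ ENNReal.ofReal (V + 2 + V * σ * ε + V * τ)
        + ENNReal.ofReal (2 * B) * ENNReal.ofReal (meanRate (P.Acc F S I t)) := by
    intro t
    have h0 : 0 ≤ meanRate (P.Acc F S I t) := meanRate_nonneg
    have hstep := startPotential_step (acc := P.Acc F S I t) (V := V) hΔ.le hp B
    have hesc : σ * (meanRate (P.Acc F S I t) - ε) - τ ≤ escapeProb (P.Acc F S I t) B p Δ :=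
      le_max_right _ _
    have hesc' := mul_le_mul_of_nonneg_right hesc hV
    have hcost := attemptCost_le (acc := P.Acc F S I t) B
    have havg := avg_trialCost_nonneg (acc := P.Acc F S I t) (B := B) (fun _ => hU0 t) hV
    rw [← ENNReal.ofReal_mul (by positivity), ← ENNReal.ofReal_mul (by positivity),
      ← ENNReal.ofReal_one, ← ENNReal.ofReal_add zero_le_one havg,
      ← ENNReal.ofReal_add (by positivity) (by positivity),
      ← ENNReal.ofReal_add (by positivity) (by positivity)]
    refine ENNReal.ofReal_le_ofReal ?_
    linarith
  refine (PMF.lexp_mono _ hpt).trans ?_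
  rw [PMF.lexp_add, PMF.lexp_const, PMF.lexp_const_mul, PMF.lexp_const_mul, hmean,
    ← ENNReal.ofReal_mul (by positivity), ← ENNReal.ofReal_mul (by positivity),
    ← ENNReal.ofReal_add (by positivity) (by positivity),
    ← ENNReal.ofReal_add (by positivity) (by positivity)]
  refine ENNReal.ofReal_le_ofReal ?_
  have hsplit : V * σ * εt = V * σ * ε + V * σ * Δ := by rw [hεΔ]; ring
  linarith

theorem potential_step (hr : 1 ≤ r) (hB : B ≠ 0) (hΔ : 0 < Δ) (hp : 0 ≤ p) (hV : 0 ≤ V)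
    (hpL : p = 2 / Fintype.card L - 1 / (Fintype.card L : ℝ) ^ 2) {εt : ℝ}
    (hεt : P.acceptProb S I (Fintype.card F) = εt)
    (hεΔ : εt = p + (1 - p) * (1 / Fintype.card (Leaf D)) + Δ)
    (hVeq : V * (B * Δ * Δ / (1 + B * Δ)) = 2 * (1 + εt * B))
    (ho : Extractor.output F S I P h = none) :
    1 + ((pairExtractor L n k D B).step F S I P h).lexp (potential F S I P B p Δ V)
      ≤ potential F S I P B p Δ V h := by
  classical
  -- Histories without any `Bound` have potential `∞`, so only the situations listed there need
  -- checking.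
  refine le_iInf₂ fun v hv => ?_
  cases hv with
  | halted ho' => simp [ho] at ho'
  | start hm => exact step_start hΔ hp hV hεt hεΔ hVeq ho hm
  | pair q t G hm hq hπ hG hc => exact step_pair hΔ.le hp hV ho hm hq hπ hG hc
  | firstRep q t c i f hm hq hacc hmem =>
    exact step_firstRep hr hB hΔ.le hp hV hpL ho hm hq hacc hmem
  | secondRep q t G c i f hm hq hacc hmem hπ hG hc =>
    exact step_secondRep hΔ.le hp hV ho hm hq hacc hmem hπ hG hc

end Steps

/-! ### Parameters in terms of field sizes, and conclusion. -/

theorem falsePositiveRate_eq {F K L : Type*} [Field F] [Fintype F] [Field K] [Finite K] [Field L]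
    [Fintype L] [Algebra F K] [Algebra K L] :
    falsePositiveRate (Fintype.card F) (Module.finrank F K) (Module.finrank K L)
      = 2 / Fintype.card L - 1 / (Fintype.card L : ℝ) ^ 2 := by
  have hcard : Fintype.card L
      = Fintype.card F ^ (Module.finrank F K * Module.finrank K L) := by
    rw [← Nat.card_eq_fintype_card, Module.natCard_eq_pow_finrank (K := K),
      Module.natCard_eq_pow_finrank (K := F) (V := K), Nat.card_eq_fintype_card, pow_mul]
  rw [falsePositiveRate, hcard]
  push_cast
  rw [← pow_mul]
  ring_nf

theorem falsePositiveRate_nonneg {Q : ℝ} (hQ : 1 ≤ Q) : 0 ≤ 2 / Q - 1 / Q ^ 2 := by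
  have : 2 / Q - 1 / Q ^ 2 = (2 * Q - 1) / Q ^ 2 := by field_simp
  rw [this]
  exact div_nonneg (by linarith) (by positivity)

end RankSD

end

open RankSD in
theorem mainTheorem3 {F K L : Type*} [Field F] [Fintype F] [Field K] [Finite K] [Field L]
    [Fintype L] [Algebra F K] [Algebra K L] (q m η n k r D : ℕ)
    (hq : Fintype.card F = q) (hm : Module.finrank F K = m) (hη : Module.finrank K L = η)
    (hkn : k ≤ n) (hr : 1 ≤ r) (εt : ℝ) (hε : soundnessError q m η D < εt) :
    ∃ E : Extractor L n k D,
      ∀ {Seed Salt Rnd Cmt Dig Tape : Type*}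
        (S : Primitives K L k r D Seed Salt Rnd Cmt Dig) (I : Instance K n k)
        (P : Prover K L n k r D Seed Salt Cmt Dig Tape),
        P.acceptProb S I q = εt →
        Filter.Tendsto (fun t => E.successProb F S I P t) Filter.atTop (nhds 1) ∧
        E.expectedCalls F S I P ≤ ENNReal.ofReal
          (4 / (εt - soundnessError q m η D) *
            (1 + 2 * εt * Real.log 2 / (εt - soundnessError q m η D))) := by
  subst hq hm hη
  set p := falsePositiveRate (Fintype.card F) (Module.finrank F K) (Module.finrank K L) with hpdef
  set ε := soundnessError (Fintype.card F) (Module.finrank F K) (Module.finrank K L) D with hεdef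
  set Δ := εt - ε with hΔdef
  have hpL : p = 2 / Fintype.card L - 1 / (Fintype.card L : ℝ) ^ 2 := falsePositiveRate_eq
  have hp : 0 ≤ p := hpL ▸ falsePositiveRate_nonneg (by exact_mod_cast Fintype.card_pos)
  have hεeq : ε = p + (1 - p) * (1 / Fintype.card (Leaf D)) := by
    simp [hεdef, soundnessError, hpdef]
  have hε0 : 0 ≤ ε := by
    have h1 : (1 : ℝ) / Fintype.card (Leaf D) ≤ 1 :=
      div_le_one_of_le₀ (by exact_mod_cast Fintype.card_pos) (by positivity)
    have h2 : (0 : ℝ) ≤ 1 / Fintype.card (Leaf D) := by positivity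
    rw [hεeq]
    nlinarith [mul_nonneg hp (sub_nonneg.2 h1)]
  have hΔ : 0 < Δ := sub_pos.2 hε
  have hεt0 : 0 < εt := hε0.trans_lt hε
  have hB := repetitions_pos hΔ
  have hB' : (0 : ℝ) < repetitions Δ := by exact_mod_cast hB
  set V := startPotential (repetitions Δ) Δ εt with hVdef
  have hV : 0 ≤ V := by rw [hVdef, startPotential]; positivity
  have hVeq : V * (repetitions Δ * Δ * Δ / (1 + repetitions Δ * Δ))
      = 2 * (1 + εt * repetitions Δ) := by
    rw [hVdef, startPotential]
    field_simp
  -- The number of repetitions depends on `Δ` alone, so the extractor is chosen before the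
  -- primitives, the instance and the prover.
  refine ⟨pairExtractor L n k D (repetitions Δ), fun S I P hacc => ?_⟩
  -- Supplies `Δ ≤ 1`, which the numerical bound needs.
  have hεt1 : εt ≤ 1 := hacc ▸ acceptProb_le_one
  have hstep := fun h => potential_step (F := F) (S := S) (I := I) (P := P) (h := h) hr hB.ne' hΔ hp
    hV hpL hacc (by rw [← hεeq, hΔdef]; ring) hVeq
  have hnil : potential F S I P (repetitions Δ) p Δ V [] ≤ ENNReal.ofReal V :=
    potential_le (.start rfl)
  refine ⟨Extractor.tendsto_successProb _ F S I P _ hstep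
    (ne_top_of_le_ne_top ENNReal.ofReal_ne_top hnil),
    (Extractor.expectedCalls_le _ F S I P _ hstep).trans (hnil.trans ?_)⟩
  exact ENNReal.ofReal_le_ofReal (startPotential_le hΔ (by linarith) (by linarith))
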